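/- Let $M$ be a Polish space with its Borel $\sigma$-algebra and $\lambda$ a $\sigma$-finite Borel measure on $M$. Let $\mathbb M$ be the set of finite Borel measures on $M$, $\mathbb M^{ac}=\{\mu\in\mathbb M:\mu\ll\lambda\}$ and $\mathscr P^{ac}=\{\mu\in\mathbb M^{ac}:\mu(M)=1\}$, both with the total variation distance $\rho_{var}(\mu,\nu)=\int_M\big|\frac{d\mu}{d\lambda}-\frac{d\nu}{d\lambda}\big|\,d\lambda$ and its Borel $\sigma$-algebra. Let $\Lambda$ be a Borel probability measure on $\mathbb M^{ac}$. *Dirichlet forms.* For a metric space $E$ with a Borel probability measure $\Lambda$, a (symmetric) Dirichlet form $(\mathcal E,D(\mathcal E))$ on $L^2(E,\Lambda)$ is a symmetric, nonnegative bilinear form on a dense subspace $D(\mathcal E)$ that is complete for the norm $\mathcal E_1(u,u)^{1/2}$, $\mathcal E_1(u,u)=\mathcal E(u,u)+\Lambda(u^2)$, and such that $w=u^+\wedge1\in D(\mathcal E)$ and $\mathcal E(u+w,u-w)\ge0$ for all $u\in D(\mathcal E)$. Put $\mathcal E(u,u)=\infty$ if $u\notin D(\mathcal E)$. For open $O\subseteq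 E$ let $\mathrm{Cap}_1(O)=\inf\{\mathcal E_1(u,u):u\in D(\mathcal E),\ u\ge1\ \Lambda\text{-a.e. on }O\}$, with $\inf\emptyset=\infty$, and for any $A\subseteq E$ let $\mathrm{Cap}_1(A)=\inf\{\mathrm{Cap}_1(O):O\supseteq A\text{ open}\}$. A nest is a sequence of closed sets $K_n$ with $\mathrm{Cap}_1(E\setminus K_n)\to0$. A measurable $f:E\to\mathbb R$ is quasi-continuous if there is a nest $(K_n)$ with every $f|_{K_n}$ continuous. The form is quasi-regular if - (Q1) there is a nest of compact sets; - (Q2) $(D(\mathcal E),\mathcal E_1^{1/2})$ has a dense linear subspace whose elements are represented by quasi-continuous functions; - (Q3) there are $N\subseteq E$ with $\mathrm{Cap}_1(N)=0$ and a sequence of quasi-continuous functions representing elements of $D(\mathcal E)$ that separates the points of $E\setminus N$. *Derivatives.* Let $\mathscr X$ be the set of functions $u(\mu)=g(\mu(f_1),\dots,\mu(f_n))$ on $\mathbb M$ with $n\in\mathbb N$, $f_i\in C_b(M)$, $g\in C_b^1(\mathbb R^n)$. For $u\in\mathscr X$ and $x\in M$ put $D^Eu(\mu)(x)=\lim_{\varepsilon\downarrow0}\frac{u(\mu+\varepsilon\delta_x)-u(\mu)}{\varepsilon}$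 and $\tilde D^Eu(\mu)(x)=\lim_{\varepsilon\downarrow0}\frac{u((1-\varepsilon)\mu+\varepsilon\delta_x)-u(\mu)}{\varepsilon}$; also $\|u\|_\infty=\sup_{\mu\in\mathbb M}|u(\mu)|$ and $\|f\|_{L^1(\mu)+L^\infty(\mu)}:=\|f\|_{L^1(\mu)}+\|f\|_{L^\infty(\mu)}$. **Theorem.** Let $(\mathcal E,D(\mathcal E))$ be a Dirichlet form on $L^2(\mathbb M^{ac},\Lambda)$ such that $(D(\mathcal E),\mathcal E_1^{1/2})$ has a dense linear subspace whose elements are represented by quasi-continuous functions. 1. If there is $C\in(0,\infty)$ with $$\mathcal E(u,u)\le C\Big(\sup_{\mu\in\mathbb M^{ac}}\|D^Eu(\mu)\|^2_{L^1(\mu)+L^\infty(\mu)}+\|u\|_\infty^2\Big),\qquad u\in\mathscr X$$ (no condition is imposed on those $u$ for which the right-hand side is infinite), then $(\mathcal E,D(\mathcal E))$ is quasi-regular. 2. If $\Lambda(\mathscr P^{ac})=1$ and there is $C\in(0,\infty)$ with $$\mathcal E(u,u)\le C\Big(\sup_{\mu\in\mathscr P^{ac}}\|\tilde D^Eu(\mu)\|^2_{L^\infty(\mu)}+\|u\|_\infty^2\Big),\qquad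 u\in\mathscr X,$$ then $(\mathcal E,D(\mathcal E))$ is quasi-regular. Moreover, under the identification $L^2(\mathbb M^{ac},\Lambda)=L^2(\mathscr P^{ac},\Lambda)$ given by restriction of functions to $\mathscr P^{ac}$, it is also a quasi-regular Dirichlet form on $L^2(\mathscr P^{ac},\Lambda)$. -/

import Mathlib

open MeasureTheory Filter Set
open scoped ENNReal NNReal Topology BoundedContinuousFunction

noncomputable section

/-! ### Bilinear forms on `L²`, Dirichlet forms, capacity, quasi-regularity -/

/-- A bilinear form on a linear subspace (its domain) of the real space `L²(E, Λ)`. -/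
structure L2Form {E : Type*} [MeasurableSpace E] (Λ : Measure E) where
  domain : Submodule ℝ (Lp ℝ 2 Λ)
  form : LinearMap.BilinForm ℝ domain

namespace L2Form

variable {E : Type*} [MeasurableSpace E] {Λ : Measure E}

/-- `𝓔₁(u, u) = 𝓔(u, u) + Λ(u²)`. -/
def energyOne (𝓔 : L2Form Λ) (u : 𝓔.domain) : ℝ :=
  𝓔.form u u + ‖(u : Lp ℝ 2 Λ)‖ ^ 2

/-- Symmetric Dirichlet forms: densely defined, symmetric, nonnegative, closed (the domain is
complete for the `𝓔₁`-norm), and Markovian (`w = u⁺ ∧ 1` belongs to the domain and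
`𝓔(u + w, u - w) ≥ 0`). -/
structure IsDirichletForm (𝓔 : L2Form Λ) : Prop where
  dense : Dense (𝓔.domain : Set (Lp ℝ 2 Λ))
  symm : ∀ u v : 𝓔.domain, 𝓔.form u v = 𝓔.form v u
  nonneg : ∀ u : 𝓔.domain, 0 ≤ 𝓔.form u u
  complete : ∀ u : ℕ → 𝓔.domain,
    (∀ ε : ℝ, 0 < ε → ∃ N : ℕ, ∀ m ≥ N, ∀ n ≥ N, 𝓔.energyOne (u m - u n) < ε) →
    ∃ v : 𝓔.domain, Tendsto (fun n => 𝓔.energyOne (u n - v)) atTop (𝓝 0)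
  markov : ∀ u : 𝓔.domain, ∃ w : 𝓔.domain,
    ((w : Lp ℝ 2 Λ) =ᵐ[Λ] fun z => min (max ((u : Lp ℝ 2 Λ) z) 0) 1) ∧
      0 ≤ 𝓔.form (u + w) (u - w)

/-- `𝓔(f, f)` for a function `f`, with the convention that it is `∞` when `f` does not represent
an element of the domain (the infimum is over at most one element). -/
def energy (𝓔 : L2Form Λ) (f : E → ℝ) : ℝ≥0∞ :=
  ⨅ (u : 𝓔.domain) (_ : (u : Lp ℝ 2 Λ) =ᵐ[Λ] f), ENNReal.ofReal (𝓔.form u u)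

/-- The infimum of `𝓔₁(u, u)` over `u` in the domain with `u ≥ 1` a.e. on `O`, for open `O`. -/
def capOpen (𝓔 : L2Form Λ) (O : Set E) : ℝ≥0∞ :=
  ⨅ (u : 𝓔.domain) (_ : ∀ᵐ z ∂Λ, z ∈ O → 1 ≤ (u : Lp ℝ 2 Λ) z),
    ENNReal.ofReal (𝓔.energyOne u)

variable [TopologicalSpace E]

/-- The `1`-capacity of an arbitrary set. -/
def cap (𝓔 : L2Form Λ) (A : Set E) : ℝ≥0∞ :=
  ⨅ (O : Set E) (_ : IsOpen O) (_ : A ⊆ O), 𝓔.capOpen O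

/-- A nest: closed sets whose complements have capacity tending to zero. -/
def IsNest (𝓔 : L2Form Λ) (K : ℕ → Set E) : Prop :=
  (∀ n, IsClosed (K n)) ∧ Tendsto (fun n => 𝓔.cap (K n)ᶜ) atTop (𝓝 0)

/-- Quasi-continuous functions. -/
def QuasiContinuous (𝓔 : L2Form Λ) (f : E → ℝ) : Prop :=
  Measurable f ∧ ∃ K : ℕ → Set E, 𝓔.IsNest K ∧ ∀ n, ContinuousOn f (K n)

/-- The domain, with the `𝓔₁`-norm, has a dense linear subspace consisting of (classes of)
quasi-continuous functions. -/
def HasDenseQuasiContinuous (𝓔 : L2Form Λ) : Prop :=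
  ∃ S : Submodule ℝ 𝓔.domain,
    (∀ u ∈ S, ∃ f : E → ℝ, 𝓔.QuasiContinuous f ∧ ((u : Lp ℝ 2 Λ) =ᵐ[Λ] f)) ∧
    ∀ u : 𝓔.domain, ∀ ε : ℝ, 0 < ε → ∃ v ∈ S, 𝓔.energyOne (u - v) < ε

/-- Quasi-regularity. -/
structure IsQuasiRegular (𝓔 : L2Form Λ) : Prop where
  compact_nest : ∃ K : ℕ → Set E, 𝓔.IsNest K ∧ ∀ n, IsCompact (K n)
  dense_quasiContinuous : 𝓔.HasDenseQuasiContinuous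
  separating : ∃ (N : Set E) (f : ℕ → E → ℝ), 𝓔.cap N = 0 ∧
    (∀ n, 𝓔.QuasiContinuous (f n) ∧ ∃ u : 𝓔.domain, (u : Lp ℝ 2 Λ) =ᵐ[Λ] f n) ∧
    ∀ z₁ ∉ N, ∀ z₂ ∉ N, z₁ ≠ z₂ → ∃ n, f n z₁ ≠ f n z₂

end L2Form

/-! ### Restriction of a form to a set of full measure -/

lemma measurePreserving_subtypeVal_of_ae_mem {E : Type*} [MeasurableSpace E] {Λ : Measure E}
    {s : Set E} (hs : MeasurableSet s) (h : ∀ᵐ z ∂Λ, z ∈ s) :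
    MeasurePreserving (Subtype.val : s → E) (Λ.comap Subtype.val) Λ :=
  ⟨measurable_subtype_coe, by
    rw [map_comap_subtype_coe hs, Measure.restrict_eq_self_of_ae_mem h]⟩

/-- If `s` carries `Λ`, a form on `L²(E, Λ)` viewed as a form on `L²(s, Λ)`: its domain consists
of the restrictions `u|ₛ` of the elements `u` of the domain, and the value at `(u|ₛ, v|ₛ)` is
`𝓔(u, v)`. Here `s` has the induced `σ`-algebra and `Λ` is restricted to it. -/
def L2Form.restrict {E : Type*} [MeasurableSpace E] {Λ : Measure E} (𝓔 : L2Form Λ)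
    {s : Set E} (hs : MeasurableSet s) (h : ∀ᵐ z ∂Λ, z ∈ s) :
    L2Form (Λ.comap (Subtype.val : s → E)) :=
  let R : Lp ℝ 2 Λ →ₗᵢ[ℝ] Lp ℝ 2 (Λ.comap (Subtype.val : s → E)) :=
    Lp.compMeasurePreservingₗᵢ ℝ Subtype.val (measurePreserving_subtypeVal_of_ae_mem hs h)
  let e := Submodule.equivMapOfInjective R.toLinearMap R.injective 𝓔.domain
  { domain := 𝓔.domain.map R.toLinearMap
    form := 𝓔.form.compl₁₂ e.symm.toLinearMap e.symm.toLinearMap }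

/-! ### Absolutely continuous measures with the total variation distance -/

/-- Finite measures on `M` that are absolutely continuous with respect to `lam`. -/
@[ext]
structure AcMeasure {M : Type*} [MeasurableSpace M] (lam : Measure M) where
  toFiniteMeasure : FiniteMeasure M
  ac : (toFiniteMeasure : Measure M) ≪ lam

namespace AcMeasure

variable {M : Type*} [MeasurableSpace M] {lam : Measure M}

/-- The density `dμ/dlam`. -/
def density (μ : AcMeasure lam) (x : M) : ℝ :=
  ((μ.toFiniteMeasure : Measure M).rnDeriv lam x).toReal

lemma integrable_density (μ : AcMeasure lam) : Integrable μ.density lam :=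
  Measure.integrable_toReal_rnDeriv

lemma integrable_abs_sub (μ ν : AcMeasure lam) :
    Integrable (fun x => |μ.density x - ν.density x|) lam :=
  (μ.integrable_density.sub ν.integrable_density).abs

lemma eq_of_density_ae_eq [SigmaFinite lam] {μ ν : AcMeasure lam}
    (h : μ.density =ᵐ[lam] ν.density) : μ = ν := by
  have key : (μ.toFiniteMeasure : Measure M) = (ν.toFiniteMeasure : Measure M) := by
    rw [← Measure.withDensity_rnDeriv_eq _ _ μ.ac, ← Measure.withDensity_rnDeriv_eq _ _ ν.ac]
    refine withDensity_congr_ae ?_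
    filter_upwards [h, Measure.rnDeriv_lt_top (μ.toFiniteMeasure : Measure M) lam,
      Measure.rnDeriv_lt_top (ν.toFiniteMeasure : Measure M) lam] with x hx h1 h2
    exact (ENNReal.toReal_eq_toReal_iff' h1.ne h2.ne).1 hx
  ext1
  exact Subtype.ext key

/-- The total variation distance, `|μ - ν|(M) = ∫ |dμ/dlam - dν/dlam| dlam`. -/
instance [SigmaFinite lam] : MetricSpace (AcMeasure lam) where
  dist μ ν := ∫ x, |μ.density x - ν.density x| ∂lam
  dist_self μ := by simp
  dist_comm μ ν := by simp only [abs_sub_comm]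
  dist_triangle μ ν κ := by
    rw [← integral_add (integrable_abs_sub μ ν) (integrable_abs_sub ν κ)]
    exact integral_mono (integrable_abs_sub μ κ)
      ((integrable_abs_sub μ ν).add (integrable_abs_sub ν κ)) fun x => abs_sub_le _ _ _
  eq_of_dist_eq_zero := by
    intro μ ν h
    apply eq_of_density_ae_eq
    have h' := (integral_eq_zero_iff_of_nonneg (fun x => abs_nonneg _)
      (integrable_abs_sub μ ν)).1 h
    filter_upwards [h'] with x hx
    exact sub_eq_zero.1 (abs_eq_zero.1 hx)

lemma dist_def [SigmaFinite lam] (μ ν : AcMeasure lam) :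
    dist μ ν = ∫ x, |μ.density x - ν.density x| ∂lam := rfl

instance [SigmaFinite lam] : MeasurableSpace (AcMeasure lam) := borel _

instance [SigmaFinite lam] : BorelSpace (AcMeasure lam) := ⟨rfl⟩

end AcMeasure

/-- The absolutely continuous probability measures, as a subset of the absolutely continuous
finite measures. -/
def probAc {M : Type*} [MeasurableSpace M] (lam : Measure M) : Set (AcMeasure lam) :=
  {μ | (μ.toFiniteMeasure : Measure M) Set.univ = 1}

lemma integral_density_eq {M : Type*} [MeasurableSpace M] {lam : Measure M} [SigmaFinite lam]
    (μ : AcMeasure lam) :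
    ∫ x, μ.density x ∂lam = (μ.toFiniteMeasure : Measure M).real Set.univ :=
  Measure.integral_toReal_rnDeriv μ.ac

lemma isClosed_probAc {M : Type*} [MeasurableSpace M] (lam : Measure M) [SigmaFinite lam] :
    IsClosed (probAc lam) := by
  have hc : Continuous fun μ : AcMeasure lam => ∫ x, μ.density x ∂lam := by
    refine (LipschitzWith.of_dist_le_mul (K := 1) fun μ ν => ?_).continuous
    rw [Real.dist_eq, ← integral_sub μ.integrable_density ν.integrable_density, NNReal.coe_one,
      one_mul, AcMeasure.dist_def]
    exact abs_integral_le_integral_abs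
  have : probAc lam = (fun μ : AcMeasure lam => ∫ x, μ.density x ∂lam) ⁻¹' {1} := by
    ext μ
    simp only [probAc, mem_ofPred_eq, mem_preimage, mem_singleton_iff, integral_density_eq,
      Measure.real]
    rw [ENNReal.toReal_eq_one_iff]
  rw [this]
  exact isClosed_singleton.preimage hc

/-- The form on `L²` of the finite absolutely continuous measures, viewed as a form on `L²` of the
absolutely continuous probability measures, when these carry `Λ`. -/
def L2Form.toProbAc {M : Type*} [MeasurableSpace M] {lam : Measure M} [SigmaFinite lam]
    {Λ : Measure (AcMeasure lam)} [IsProbabilityMeasure Λ] (𝓔 : L2Form Λ)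
    (h : Λ (probAc lam) = 1) :
    L2Form (Λ.comap (Subtype.val : probAc lam → AcMeasure lam)) :=
  𝓔.restrict (isClosed_probAc lam).measurableSet
    ((mem_ae_iff_prob_eq_one (isClosed_probAc lam).measurableSet).2 h)

/-! ### Cylinder functions and extrinsic derivatives -/

/-- Cylinder functions `μ ↦ g(μ(f₁), …, μ(fₙ))` on the space of finite measures, with
`fᵢ ∈ C_b(M)` and `g ∈ C_b¹(ℝⁿ)`, that is, `g` is `C¹` and bounded with bounded derivative. -/
def IsCylinder {M : Type*} [TopologicalSpace M] [MeasurableSpace M]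
    (u : FiniteMeasure M → ℝ) : Prop :=
  ∃ (n : ℕ) (f : Fin n → (M →ᵇ ℝ)) (g : (Fin n → ℝ) → ℝ),
    ContDiff ℝ 1 g ∧ (∃ B : ℝ, ∀ y, |g y| ≤ B ∧ ‖fderiv ℝ g y‖ ≤ B) ∧
    ∀ μ : FiniteMeasure M, u μ = g fun i => ∫ x, f i x ∂(μ : Measure M)

/-- The Dirac measure as a finite measure. -/
def diracFin {M : Type*} [MeasurableSpace M] (x : M) : FiniteMeasure M :=
  ⟨Measure.dirac x, inferInstance⟩

/-- The extrinsic derivative `lim_{ε ↓ 0} (u(μ + ε δₓ) - u(μ)) / ε`. -/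
def extrinsicDeriv {M : Type*} [MeasurableSpace M] (u : FiniteMeasure M → ℝ) (μ : FiniteMeasure M)
    (x : M) : ℝ :=
  derivWithin (fun ε : ℝ => u (μ + ε.toNNReal • diracFin x)) (Ici 0) 0

/-- The convexity extrinsic derivative `lim_{ε ↓ 0} (u((1 - ε) μ + ε δₓ) - u(μ)) / ε`. -/
def convExtrinsicDeriv {M : Type*} [MeasurableSpace M] (u : FiniteMeasure M → ℝ)
    (μ : FiniteMeasure M) (x : M) : ℝ :=
  derivWithin (fun ε : ℝ => u ((1 - ε).toNNReal • μ + ε.toNNReal • diracFin x)) (Ici 0) 0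

/-- `‖u‖_∞`, the supremum over all finite measures. -/
def supNorm {M : Type*} [MeasurableSpace M] (u : FiniteMeasure M → ℝ) : ℝ≥0∞ :=
  ⨆ μ : FiniteMeasure M, ‖u μ‖ₑ

/-- `‖f‖_{L¹(μ)} + ‖f‖_{L^∞(μ)}`. -/
def normL1PlusLinf {M : Type*} [MeasurableSpace M] (f : M → ℝ) (μ : Measure M) : ℝ≥0∞ :=
  eLpNorm f 1 μ + eLpNorm f ∞ μ

/-- `𝓔(u, u) ≤ C (sup_μ ‖Du(μ)‖²_{L¹(μ)+L^∞(μ)} + ‖u‖²_∞)` for all cylinder functions `u`, where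
`D` is the extrinsic derivative and `μ` ranges over the absolutely continuous finite measures.
There is no restriction on `u` for which the right-hand side is infinite. -/
def ExtDerivBound {M : Type*} [TopologicalSpace M] [MeasurableSpace M] {lam : Measure M}
    [SigmaFinite lam] {Λ : Measure (AcMeasure lam)} (𝓔 : L2Form Λ) (C : ℝ≥0) : Prop :=
  ∀ u : FiniteMeasure M → ℝ, IsCylinder u →
    𝓔.energy (fun μ => u μ.toFiniteMeasure) ≤
      C * ((⨆ μ : AcMeasure lam,
        normL1PlusLinf (extrinsicDeriv u μ.toFiniteMeasure) (μ.toFiniteMeasure : Measure M) ^ 2)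
          + supNorm u ^ 2)

/-- `𝓔(u, u) ≤ C (sup_μ ‖D̃u(μ)‖²_{L^∞(μ)} + ‖u‖²_∞)` for all cylinder functions `u`, where `D̃`
is the convexity extrinsic derivative and `μ` ranges over the absolutely continuous probability
measures. -/
def ConvExtDerivBound {M : Type*} [TopologicalSpace M] [MeasurableSpace M] {lam : Measure M}
    [SigmaFinite lam] {Λ : Measure (AcMeasure lam)} (𝓔 : L2Form Λ) (C : ℝ≥0) : Prop :=
  ∀ u : FiniteMeasure M → ℝ, IsCylinder u →
    𝓔.energy (fun μ => u μ.toFiniteMeasure) ≤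
      C * ((⨆ μ ∈ probAc lam,
        eLpNorm (convExtrinsicDeriv u μ.toFiniteMeasure) ∞ (μ.toFiniteMeasure : Measure M) ^ 2)
          + supNorm u ^ 2)

end

/-!
Total variation distance is a supremum of differences `μ(f) - ν(f)` over countably many test
functions with `|f| ≤ 1`. Hence, for a fixed centre `ν`, the relative distance
`ρ(μ, ν) / (⟨μ(M)⟩ + ρ(μ, ν))` with `⟨t⟩ = √(1 + t²)` is a limit of cylinder functions, obtained
from smooth maxima. Their extrinsic derivatives at `μ` are bounded by a multiple of `⟨μ(M)⟩⁻¹`, and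
this decay is what keeps the `L¹(μ)`-norm bounded on measures of arbitrary mass. So their energies
are bounded, uniformly even over minima of finitely many relative distances, and by completeness all
these minima lie in a bounded subset of the domain.

Along a dense sequence of centres the minima decrease to `0`. By Mazur's lemma, convex combinations
of them have small `𝓔₁`-norm, so, up to a set of small capacity, the minima converge to `0`
uniformly. A set on which they do so is totally bounded, and hence its closure is compact.
-/

section HilbertSpace

variable {H : Type*} [NormedAddCommGroup H] [InnerProductSpace ℝ H]

theorem exists_norm_sub_sq_le_of_convex {K : Set H} (hconv : Convex ℝ K) (hne : K.Nonempty)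
    (hcomp : IsComplete K) : ∃ x ∈ K, ∀ y ∈ K, ‖y - x‖ ^ 2 ≤ ‖y‖ ^ 2 - ‖x‖ ^ 2 := by
  obtain ⟨x, hx, hmin⟩ := exists_norm_eq_iInf_of_complete_convex hne hcomp hconv 0
  refine ⟨x, hx, fun y hy => ?_⟩
  have hinner := (norm_eq_iInf_iff_real_inner_le_zero hconv hx).1 hmin y hy
  rw [zero_sub, inner_neg_left, inner_sub_right, real_inner_self_eq_norm_sq,
    real_inner_comm] at hinner
  rw [norm_sub_sq_real]
  linarith

variable [CompleteSpace H]

theorem nonempty_iInter_of_antitone_convex {K : ℕ → Set H} (hanti : Antitone K)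
    (hne : ∀ n, (K n).Nonempty) (hclosed : ∀ n, IsClosed (K n)) (hconv : ∀ n, Convex ℝ (K n))
    (hbdd : Bornology.IsBounded (K 0)) : (⋂ n, K n).Nonempty := by
  choose x hxK hx using fun n =>
    exists_norm_sub_sq_le_of_convex (hconv n) (hne n) (hclosed n).isComplete
  have hpyth {m n : ℕ} (h : m ≤ n) : ‖x n - x m‖ ^ 2 ≤ ‖x n‖ ^ 2 - ‖x m‖ ^ 2 :=
    hx m _ (hanti h (hxK n))
  have hmono : Monotone fun n => ‖x n‖ ^ 2 := fun m n h => by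
    linarith [hpyth h, sq_nonneg ‖x n - x m‖]
  obtain ⟨c, hc⟩ := hbdd.exists_norm_le
  have hbound : BddAbove (range fun n => ‖x n‖ ^ 2) :=
    ⟨c ^ 2, forall_mem_range.2 fun n =>
      pow_le_pow_left₀ (norm_nonneg _) (hc _ (hanti n.zero_le (hxK n))) 2⟩
  set s := ⨆ n, ‖x n‖ ^ 2
  have hlim : Tendsto (fun n => ‖x n‖ ^ 2) atTop (𝓝 s) := tendsto_atTop_ciSup hmono hbound
  have hcauchy : CauchySeq x := by
    refine cauchySeq_of_le_tendsto_0' (fun n => √(s - ‖x n‖ ^ 2)) (fun m n h => ?_) ?_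
    · rw [dist_eq_norm']
      exact Real.le_sqrt_of_sq_le
        ((hpyth h).trans (sub_le_sub_right (le_ciSup hbound n) _))
    · simpa using (hlim.const_sub s).sqrt
  obtain ⟨y, hy⟩ := cauchySeq_tendsto_of_complete hcauchy
  exact ⟨y, mem_iInter.2 fun n => (hclosed n).mem_of_tendsto hy
    ((eventually_ge_atTop n).mono fun k hk => hanti hk (hxK k))⟩

variable {F : Type*} [NormedAddCommGroup F] [NormedSpace ℝ F]

theorem exists_norm_le_and_map_eq_of_convex {C : Set H} (hconv : Convex ℝ C)
    (hclosed : IsClosed C) (ι : H →L[ℝ] F) {u : ℕ → H} {c : ℝ} (huC : ∀ n, u n ∈ C)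
    (hu : ∀ n, ‖u n‖ ≤ c) {w : F} (hw : Tendsto (fun n => ι (u n)) atTop (𝓝 w)) :
    ∃ x ∈ C, ‖x‖ ≤ c ∧ ι x = w := by
  set K : ℕ → Set H := fun n =>
    C ∩ Metric.closedBall 0 c ∩ ι ⁻¹' Metric.closedBall w (1 / ((n : ℝ) + 1))
  have hne (n : ℕ) : (K n).Nonempty := by
    obtain ⟨k, hk⟩ := (hw.eventually
      (Metric.closedBall_mem_nhds w (Nat.one_div_pos_of_nat (α := ℝ) (n := n)))).exists
    exact ⟨u k, ⟨huC k, mem_closedBall_zero_iff.2 (hu k)⟩, hk⟩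
  obtain ⟨x, hx⟩ := nonempty_iInter_of_antitone_convex (K := K)
    (fun m n h => inter_subset_inter_right _ <| preimage_mono <|
      Metric.closedBall_subset_closedBall (Nat.one_div_le_one_div h)) hne
    (fun n => (hclosed.inter Metric.isClosed_closedBall).inter
      (Metric.isClosed_closedBall.preimage ι.continuous))
    (fun n => (hconv.inter (convex_closedBall 0 c)).inter
      ((convex_closedBall w _).linear_preimage ι.toLinearMap))
    (Metric.isBounded_closedBall.subset (inter_subset_left.trans inter_subset_right))
  rw [mem_iInter] at hx
  exact ⟨x, (hx 0).1.1, mem_closedBall_zero_iff.1 (hx 0).1.2, dist_le_zero.1 <|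
    ge_of_tendsto tendsto_one_div_add_atTop_nhds_zero_nat (Eventually.of_forall fun n => (hx n).2)⟩

variable [PartialOrder F] [IsOrderedAddMonoid F] [PosSMulMono ℝ F]

/- A weak limit point of `u` in `H` is mapped to `0`, so it is `0`; it lies in the closure of the
convex set of all `v` such that `ι v` dominates a term of the sequence. -/
theorem exists_norm_lt_and_map_le {ι : H →L[ℝ] F} (hι : Function.Injective ι) {u : ℕ → H} {c : ℝ}
    (hu : ∀ n, ‖u n‖ ≤ c) (hanti : Antitone fun n => ι (u n))
    (hlim : Tendsto (fun n => ι (u n)) atTop (𝓝 0)) {δ : ℝ} (hδ : 0 < δ) :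
    ∃ (n : ℕ) (v : H), ‖v‖ < δ ∧ ι (u n) ≤ ι v := by
  set D : Set H := ⋃ n, {v | ι (u n) ≤ ι v}
  have hconv : Convex ℝ D := Directed.convex_iUnion
    (directed_of_isDirected_le fun m n h v hv => (hanti h).trans hv)
    (fun n => (convex_Ici (ι (u n))).linear_preimage ι.toLinearMap)
  obtain ⟨x, hx, -, hx0⟩ := exists_norm_le_and_map_eq_of_convex hconv.closure isClosed_closure
    ι (fun n => subset_closure (mem_iUnion.2 ⟨n, le_rfl⟩)) hu hlim
  obtain rfl : x = 0 := hι (hx0.trans (map_zero ι).symm)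
  obtain ⟨v, hv, hvδ⟩ := Metric.mem_closure_iff.1 hx δ hδ
  obtain ⟨n, hn⟩ := mem_iUnion.1 hv
  exact ⟨n, v, by rwa [dist_zero_left] at hvδ, hn⟩

end HilbertSpace

instance {E G : Type*} [MeasurableSpace E] {Λ : Measure E} {p : ℝ≥0∞} [NormedAddCommGroup G]
    [NormedSpace ℝ G] [PartialOrder G] [PosSMulMono ℝ G] : PosSMulMono ℝ (Lp G p Λ) where
  smul_le_smul_of_nonneg_left a ha u v huv := by
    rw [← Lp.coeFn_le] at huv ⊢
    filter_upwards [huv, Lp.coeFn_smul a u, Lp.coeFn_smul a v] with z hz hu hv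
    rw [hu, hv]
    exact smul_le_smul_of_nonneg_left hz ha

theorem tendsto_Lp_of_bounded {E G : Type*} [MeasurableSpace E] {Λ : Measure E}
    [IsFiniteMeasure Λ] [NormedAddCommGroup G] {p : ℝ≥0∞} [Fact (1 ≤ p)] (hp : p ≠ ∞)
    {u : ℕ → Lp G p Λ} {w : Lp G p Λ} {f : ℕ → E → G} {g : E → G} (hu : ∀ n, u n =ᵐ[Λ] f n)
    (hw : w =ᵐ[Λ] g) {B : ℝ} (hB : ∀ n z, ‖f n z‖ ≤ B)
    (hlim : ∀ z, Tendsto (fun n => f n z) atTop (𝓝 (g z))) : Tendsto u atTop (𝓝 w) := by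
  have hf (n : ℕ) : MemLp (f n) p Λ := (Lp.memLp (u n)).ae_eq (hu n)
  have hunif : UnifIntegrable f p Λ := by
    refine unifIntegrable_of Fact.out hp (fun n => (hf n).1) fun _ _ =>
      ⟨B.toNNReal + 1, fun n => ?_⟩
    have hempty : {z | B.toNNReal + 1 ≤ ‖f n z‖₊} = ∅ := by
      refine eq_empty_iff_forall_notMem.2 fun z hz => ?_
      have : (B.toNNReal : ℝ) + 1 ≤ ‖f n z‖ := mod_cast hz
      linarith [hB n z, Real.le_coe_toNNReal B]
    simp [hempty]
  rw [Lp.tendsto_Lp_iff_tendsto_eLpNorm']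
  refine (tendsto_Lp_finite_of_tendsto_ae Fact.out hp (fun n => (hf n).1)
    ((Lp.memLp w).ae_eq hw) hunif (Eventually.of_forall hlim)).congr fun n => ?_
  exact eLpNorm_congr_ae ((hu n).symm.sub hw.symm)

namespace L2Form

variable {E : Type*} [MeasurableSpace E] {Λ : Measure E} {𝓔 : L2Form Λ}

theorem exists_of_energy_le {f : E → ℝ} {c : ℝ≥0} (hf : 𝓔.energy f ≤ c) :
    ∃ u : 𝓔.domain, (u : Lp ℝ 2 Λ) =ᵐ[Λ] f ∧ 𝓔.form u u ≤ c + 1 := by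
  have hlt : 𝓔.energy f < ((c + 1 : ℝ≥0) : ℝ≥0∞) :=
    hf.trans_lt (ENNReal.coe_lt_coe.2 (lt_add_one c))
  simp only [energy, iInf_lt_iff] at hlt
  obtain ⟨u, hu, hlt⟩ := hlt
  rw [← ENNReal.ofReal_coe_nnreal, ENNReal.ofReal_lt_ofReal_iff'] at hlt
  exact ⟨u, hu, by simpa using hlt.1.le⟩

theorem capOpen_empty (𝓔 : L2Form Λ) : 𝓔.capOpen ∅ = 0 := by
  refine le_antisymm ((iInf₂_le (0 : 𝓔.domain) (by simp)).trans ?_) zero_le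
  simp [energyOne]

section Topology

variable [TopologicalSpace E]

theorem cap_le_capOpen (𝓔 : L2Form Λ) {O : Set E} (hO : IsOpen O) : 𝓔.cap O ≤ 𝓔.capOpen O :=
  iInf_le_of_le O (iInf₂_le hO Subset.rfl)

theorem cap_empty (𝓔 : L2Form Λ) : 𝓔.cap ∅ = 0 :=
  le_antisymm ((𝓔.cap_le_capOpen isOpen_empty).trans_eq 𝓔.capOpen_empty) zero_le

theorem quasiContinuous_of_continuous [OpensMeasurableSpace E] (𝓔 : L2Form Λ) {f : E → ℝ}
    (hf : Continuous f) : 𝓔.QuasiContinuous f :=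
  ⟨hf.measurable, fun _ => univ, ⟨fun _ => isClosed_univ, by simp [cap_empty]⟩,
    fun _ => hf.continuousOn⟩

end Topology

/-- Closed forms: symmetric, nonnegative, with a domain that is complete for the `𝓔₁`-norm. Unlike
a Dirichlet form, a closed form need neither be densely defined nor Markovian. -/
structure IsClosedForm (𝓔 : L2Form Λ) : Prop where
  symm : ∀ u v : 𝓔.domain, 𝓔.form u v = 𝓔.form v u
  nonneg : ∀ u : 𝓔.domain, 0 ≤ 𝓔.form u u
  complete : ∀ u : ℕ → 𝓔.domain,
    (∀ ε : ℝ, 0 < ε → ∃ N : ℕ, ∀ m ≥ N, ∀ n ≥ N, 𝓔.energyOne (u m - u n) < ε) →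
    ∃ v : 𝓔.domain, Tendsto (fun n => 𝓔.energyOne (u n - v)) atTop (𝓝 0)

theorem IsDirichletForm.isClosedForm (h : 𝓔.IsDirichletForm) : 𝓔.IsClosedForm :=
  ⟨h.symm, h.nonneg, h.complete⟩

/-- The domain of a closed form, with the Hilbert space structure given by `𝓔₁`. It is a type
synonym, because `𝓔.domain` already carries the norm of `L²`. -/
def EnergySpace (_ : 𝓔.IsClosedForm) : Type _ := 𝓔.domain

namespace EnergySpace

variable {h : 𝓔.IsClosedForm}

noncomputable instance : AddCommGroup (EnergySpace h) := inferInstanceAs (AddCommGroup 𝓔.domain)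

noncomputable instance : Module ℝ (EnergySpace h) := inferInstanceAs (Module ℝ 𝓔.domain)

/-- The identification of the domain with its type synonym. -/
noncomputable def ofDomain (h : 𝓔.IsClosedForm) : 𝓔.domain ≃ₗ[ℝ] EnergySpace h :=
  LinearEquiv.refl ℝ 𝓔.domain

/-- The inner product `𝓔₁(u, v) = 𝓔(u, v) + Λ(u v)`. -/
@[reducible]
noncomputable def innerCore (h : 𝓔.IsClosedForm) : InnerProductSpace.Core ℝ (EnergySpace h) where
  inner u v := 𝓔.form ((ofDomain h).symm u) ((ofDomain h).symm v) +
    inner ℝ ((ofDomain h).symm u : Lp ℝ 2 Λ) ((ofDomain h).symm v)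
  conj_inner_symm u v := by
    rw [real_inner_comm, h.symm]
    rfl
  re_inner_nonneg u := add_nonneg (h.nonneg _) real_inner_self_nonneg
  add_left u v w := by
    simp only [map_add, Submodule.coe_add, inner_add_left, LinearMap.add_apply]
    ring
  smul_left u v r := by
    simp only [map_smul, Submodule.coe_smul, real_inner_smul_left, LinearMap.smul_apply,
      conj_trivial, smul_eq_mul]
    ring
  definite u hu := by
    have hL : inner ℝ ((ofDomain h).symm u : Lp ℝ 2 Λ) ((ofDomain h).symm u) = 0 :=
      le_antisymm (by linarith [h.nonneg ((ofDomain h).symm u)]) real_inner_self_nonneg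
    simpa using hL

noncomputable instance : NormedAddCommGroup (EnergySpace h) := (innerCore h).toNormedAddCommGroup

noncomputable instance : InnerProductSpace ℝ (EnergySpace h) := InnerProductSpace.ofCore _

theorem norm_sq (u : EnergySpace h) : ‖u‖ ^ 2 = 𝓔.energyOne ((ofDomain h).symm u) := by
  rw [← real_inner_self_eq_norm_sq, energyOne.eq_def, ← real_inner_self_eq_norm_sq]
  rfl

theorem norm_ofDomain_le {u : 𝓔.domain} {c : ℝ} (hu : 𝓔.energyOne u ≤ c) :
    ‖ofDomain h u‖ ≤ √c :=
  Real.le_sqrt_of_sq_le (by rwa [norm_sq, LinearEquiv.symm_apply_apply])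

instance : CompleteSpace (EnergySpace h) := by
  refine Metric.complete_of_cauchySeq_tendsto fun u hu => ?_
  obtain ⟨v, hv⟩ := h.complete (fun n => (ofDomain h).symm (u n)) fun ε hε => by
    obtain ⟨N, hN⟩ := Metric.cauchySeq_iff.1 hu (√ε) (Real.sqrt_pos.2 hε)
    refine ⟨N, fun m hm n hn => ?_⟩
    have := hN m hm n hn
    rwa [dist_eq_norm, Real.lt_sqrt (norm_nonneg _), norm_sq, map_sub] at this
  refine ⟨ofDomain h v, tendsto_iff_norm_sub_tendsto_zero.2 ?_⟩
  have hsq : Tendsto (fun n => ‖u n - ofDomain h v‖ ^ 2) atTop (𝓝 0) := by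
    simpa only [norm_sq, map_sub, LinearEquiv.symm_apply_apply] using hv
  simpa using hsq.sqrt

/-- The inclusion of the domain into `L²`. -/
noncomputable def toLpL (h : 𝓔.IsClosedForm) : EnergySpace h →L[ℝ] Lp ℝ 2 Λ :=
  (𝓔.domain.subtype ∘ₗ (ofDomain h).symm.toLinearMap).mkContinuous 1 fun u => by
    rw [one_mul]
    refine (sq_le_sq₀ (norm_nonneg _) (norm_nonneg u)).1 ?_
    rw [norm_sq]
    exact le_add_of_nonneg_left (h.nonneg _)

theorem toLpL_injective : Function.Injective (toLpL h) :=
  𝓔.domain.subtype_injective.comp (ofDomain h).symm.injective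

theorem toLpL_ofDomain (u : 𝓔.domain) : toLpL h (ofDomain h u) = u := rfl

end EnergySpace

namespace IsClosedForm

open EnergySpace

variable (h : 𝓔.IsClosedForm)

include h

theorem exists_coe_eq_of_tendsto {u : ℕ → 𝓔.domain} {c : ℝ} (hu : ∀ n, 𝓔.energyOne (u n) ≤ c)
    {w : Lp ℝ 2 Λ} (hw : Tendsto (fun n => (u n : Lp ℝ 2 Λ)) atTop (𝓝 w)) :
    ∃ x : 𝓔.domain, (x : Lp ℝ 2 Λ) = w ∧ 𝓔.energyOne x ≤ c := by
  have hc : 0 ≤ c := (add_nonneg (h.nonneg (u 0)) (sq_nonneg _)).trans (hu 0)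
  obtain ⟨x, -, hxc, hx⟩ := exists_norm_le_and_map_eq_of_convex convex_univ isClosed_univ
    (toLpL h) (fun n => mem_univ (ofDomain h (u n))) (fun n => norm_ofDomain_le (hu n)) hw
  exact ⟨(ofDomain h).symm x, hx, by rwa [Real.le_sqrt (norm_nonneg _) hc, norm_sq] at hxc⟩

theorem capOpen_iUnion_le {ι : Type*} [Countable ι] {v : ι → EnergySpace h} (hv : Summable v)
    (hv0 : ∀ i, 0 ≤ toLpL h (v i)) {O : ι → Set E}
    (hO : ∀ i, ∀ᵐ z ∂Λ, z ∈ O i → 1 ≤ toLpL h (v i) z) :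
    𝓔.capOpen (⋃ i, O i) ≤ ENNReal.ofReal (‖∑' i, v i‖ ^ 2) := by
  rw [norm_sq]
  refine iInf₂_le _ ?_
  have hle (i : ι) : toLpL h (v i) ≤ᵐ[Λ] toLpL h (∑' i, v i) := by
    rw [Lp.coeFn_le, ContinuousLinearMap.map_tsum _ hv]
    exact (hv.mapL (toLpL h)).le_tsum i fun j _ => hv0 j
  filter_upwards [ae_all_iff.2 hO, ae_all_iff.2 hle] with z hzO hzle hz
  obtain ⟨i, hi⟩ := mem_iUnion.1 hz
  exact (hzO i hi).trans (hzle i)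

variable {u : ℕ → 𝓔.domain} {f : ℕ → E → ℝ} (huf : ∀ n, (u n : Lp ℝ 2 Λ) =ᵐ[Λ] f n)
  {c : ℝ} (hu : ∀ n, 𝓔.energyOne (u n) ≤ c) (hf : ∀ n z, 0 ≤ f n z) (hanti : Antitone f)
  (hlim : Tendsto (fun n => (u n : Lp ℝ 2 Λ)) atTop (𝓝 0))

include huf hu hf hanti hlim

theorem exists_norm_lt_and_one_le_of_lt {ε δ : ℝ} (hε : 0 < ε) (hδ : 0 < δ) :
    ∃ (n : ℕ) (v : EnergySpace h), ‖v‖ < δ ∧ 0 ≤ toLpL h v ∧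
      ∀ᵐ z ∂Λ, ε < f n z → 1 ≤ toLpL h v z := by
  have hantiL : Antitone fun n => (u n : Lp ℝ 2 Λ) := fun m n hmn => by
    rw [← Lp.coeFn_le]
    filter_upwards [huf m, huf n] with z hm hn
    rw [hm, hn]
    exact hanti hmn z
  obtain ⟨n, v, hv, hnv⟩ := exists_norm_lt_and_map_le (toLpL_injective (h := h))
    (fun n => norm_ofDomain_le (hu n)) hantiL hlim (mul_pos hε hδ)
  have hfv : ∀ᵐ z ∂Λ, ε⁻¹ * f n z ≤ toLpL h (ε⁻¹ • v) z := by
    rw [toLpL_ofDomain, ← Lp.coeFn_le] at hnv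
    filter_upwards [huf n, hnv, Lp.coeFn_smul ε⁻¹ (toLpL h v)] with z hz hle hsmul
    rw [map_smul, hsmul, Pi.smul_apply, smul_eq_mul, ← hz]
    exact mul_le_mul_of_nonneg_left hle (inv_pos.2 hε).le
  refine ⟨n, ε⁻¹ • v, ?_, (Lp.coeFn_nonneg _).1 ?_, ?_⟩
  · rwa [norm_smul, norm_inv, Real.norm_of_nonneg hε.le, inv_mul_lt_iff₀ hε]
  · filter_upwards [hfv] with z hz
    exact (mul_nonneg (inv_pos.2 hε).le (hf n z)).trans hz
  · filter_upwards [hfv] with z hz hεz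
    refine le_trans ?_ hz
    rw [← inv_mul_cancel₀ hε.ne']
    exact mul_le_mul_of_nonneg_left hεz.le (inv_pos.2 hε).le

theorem exists_tendsto_capOpen_iUnion {ε : ℕ → ℝ} (hε : ∀ j, 0 < ε j) :
    ∃ N : ℕ → ℕ, Tendsto
      (fun l => 𝓔.capOpen (⋃ j, {z | ε (j + l) < f (N (j + l)) z})) atTop (𝓝 0) := by
  choose N v hv hv0 hvf using fun j : ℕ =>
    h.exists_norm_lt_and_one_le_of_lt huf hu hf hanti hlim (hε j)
      (show (0 : ℝ) < (1 / 2) ^ j by positivity)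
  have hsum : Summable v :=
    Summable.of_norm_bounded summable_geometric_two fun j => (hv j).le
  have htail : Tendsto (fun l => ENNReal.ofReal (‖∑' j, v (j + l)‖ ^ 2)) atTop (𝓝 0) := by
    simpa using ENNReal.tendsto_ofReal ((tendsto_sum_nat_add v).norm.pow 2)
  exact ⟨N, tendsto_of_tendsto_of_tendsto_of_le_of_le tendsto_const_nhds htail
    (fun _ => zero_le) fun l => h.capOpen_iUnion_le ((summable_nat_add_iff l).2 hsum)
      (fun j => hv0 (j + l)) fun j => hvf (j + l)⟩

theorem exists_isNest [TopologicalSpace E] (hcont : ∀ n, Continuous (f n)) {ε : ℕ → ℝ}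
    (hε : ∀ j, 0 < ε j) :
    ∃ N : ℕ → ℕ, 𝓔.IsNest fun l => ⋂ j, {z | f (N (j + l)) z ≤ ε (j + l)} := by
  obtain ⟨N, hN⟩ := h.exists_tendsto_capOpen_iUnion huf hu hf hanti hlim hε
  have hclosed (l : ℕ) : IsClosed (⋂ j, {z | f (N (j + l)) z ≤ ε (j + l)}) :=
    isClosed_iInter fun j => isClosed_le (hcont _) continuous_const
  refine ⟨N, hclosed, tendsto_of_tendsto_of_tendsto_of_le_of_le tendsto_const_nhds hN
    (fun _ => zero_le) fun l => ?_⟩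
  refine (𝓔.cap_le_capOpen (hclosed l).isOpen_compl).trans_eq ?_
  simp only [compl_iInter, compl_ofPred, not_le]

end IsClosedForm

end L2Form

section RelDist

variable {E : Type*} [PseudoMetricSpace E] {w : E → ℝ}

/-- The distance from `c` to `x` relative to a weight `w`, with values in `[0, 1)`. -/
noncomputable def relDist (w : E → ℝ) (c x : E) : ℝ :=
  dist x c / (w x + dist x c)

/-- The relative distance from a finite family of centres. -/
noncomputable def minRelDist {ι : Type*} [Fintype ι] [Nonempty ι] (w : E → ℝ) (c : ι → E) (x : E) :
    ℝ :=
  Finset.univ.inf' Finset.univ_nonempty fun i => relDist w (c i) x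

theorem relDist_self (w : E → ℝ) (x : E) : relDist w x x = 0 := by simp [relDist]

theorem minRelDist_const {ι : Type*} [Fintype ι] [Nonempty ι] (w : E → ℝ) (c : E) :
    minRelDist w (fun _ : ι => c) = relDist w c :=
  funext fun _ => Finset.inf'_const _ _

theorem antitone_minRelDist (w : E → ℝ) (c : ℕ → E) :
    Antitone fun n => minRelDist w fun i : Fin (n + 1) => c i := fun _ n hmn x =>
  Finset.le_inf' _ _ fun i _ => Finset.inf'_le (fun i : Fin (n + 1) => relDist w (c i) x)
    (Finset.mem_univ (i.castLE (Nat.succ_le_succ hmn)))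

section Positive

variable (hw0 : ∀ x, 0 < w x)

include hw0

theorem relDist_denom_pos (c x : E) : 0 < w x + dist x c :=
  add_pos_of_pos_of_nonneg (hw0 x) dist_nonneg

theorem relDist_nonneg (c x : E) : 0 ≤ relDist w c x :=
  div_nonneg dist_nonneg (relDist_denom_pos hw0 c x).le

theorem relDist_le_one (c x : E) : relDist w c x ≤ 1 :=
  div_le_one_of_le₀ (le_add_of_nonneg_left (hw0 x).le) (relDist_denom_pos hw0 c x).le

theorem continuous_relDist (hw : Continuous w) : Continuous fun p : E × E => relDist w p.1 p.2 :=
  Continuous.div (by fun_prop) (by fun_prop) fun p => (relDist_denom_pos hw0 p.1 p.2).ne'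

theorem dist_le_of_relDist_le {c x : E} {δ : ℝ} (hδ : δ ≤ 1 / 2) (h : relDist w c x ≤ δ) :
    dist x c ≤ 2 * δ * w x := by
  rw [relDist, div_le_iff₀ (relDist_denom_pos hw0 c x)] at h
  nlinarith [dist_nonneg (x := x) (y := c)]

theorem exists_bound_of_relDist_le (hw : LipschitzWith 1 w) {S t : Set E} (ht : t.Finite)
    (hS : ∀ x ∈ S, ∃ c ∈ t, relDist w c x ≤ 1 / 4) : ∃ B : ℝ, 0 < B ∧ ∀ x ∈ S, w x ≤ B := by
  obtain ⟨B, hB⟩ := (ht.image w).bddAbove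
  refine ⟨max (2 * B) 1, lt_max_of_lt_right one_pos, fun x hx => le_max_of_le_left ?_⟩
  obtain ⟨c, hct, hc⟩ := hS x hx
  have hdist : dist x c ≤ 2 * (1 / 4) * w x := dist_le_of_relDist_le hw0 (by norm_num) hc
  have hlip : w x - w c ≤ dist x c :=
    (Real.sub_le_dist _ _).trans ((hw.dist_le_mul x c).trans_eq (one_mul _))
  linarith [hB (mem_image_of_mem w hct)]

theorem totallyBounded_of_relDist_le (hw : LipschitzWith 1 w) {S : Set E}
    (hS : ∀ δ > 0, ∃ t : Set E, t.Finite ∧ ∀ x ∈ S, ∃ c ∈ t, relDist w c x ≤ δ) :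
    TotallyBounded S := by
  obtain ⟨t, ht, htS⟩ := hS (1 / 4) (by norm_num)
  obtain ⟨B, hB, hwB⟩ := exists_bound_of_relDist_le hw0 hw ht htS
  refine Metric.totallyBounded_iff.2 fun ε hε => ?_
  obtain ⟨t, ht, htS⟩ := hS (min (1 / 2) (ε / (4 * B))) (by positivity)
  refine ⟨t, ht, fun x hx => ?_⟩
  obtain ⟨c, hct, hc⟩ := htS x hx
  refine mem_iUnion₂.2 ⟨c, hct, ?_⟩
  calc dist x c ≤ 2 * min (1 / 2) (ε / (4 * B)) * w x :=
        dist_le_of_relDist_le hw0 (min_le_left _ _) hc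
    _ ≤ 2 * (ε / (4 * B)) * B :=
        mul_le_mul (by gcongr; exact min_le_right _ _) (hwB x hx) (hw0 x).le (by positivity)
    _ = ε / 2 := by field_simp; norm_num
    _ < ε := half_lt_self hε

section MinRelDist

variable {ι : Type*} [Fintype ι] [Nonempty ι]

theorem minRelDist_nonneg (c : ι → E) (x : E) : 0 ≤ minRelDist w c x :=
  Finset.le_inf' _ _ fun i _ => relDist_nonneg hw0 (c i) x

theorem abs_minRelDist_le_one (c : ι → E) (x : E) : |minRelDist w c x| ≤ 1 := by
  rw [abs_of_nonneg (minRelDist_nonneg hw0 c x)]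
  exact (Finset.inf'_le _ (Finset.mem_univ (Classical.arbitrary ι))).trans (relDist_le_one hw0 _ x)

theorem continuous_minRelDist (hw : Continuous w) (c : ι → E) : Continuous (minRelDist w c) :=
  Continuous.finset_inf'_apply _ fun i _ =>
    (continuous_relDist hw0 hw).comp (Continuous.prodMk_right (c i))

end MinRelDist

theorem tendsto_minRelDist_zero (hw : Continuous w) {c : ℕ → E} (hc : DenseRange c) (x : E) :
    Tendsto (fun n => minRelDist w (fun i : Fin (n + 1) => c i) x) atTop (𝓝 0) := by
  refine tendsto_order.2 ⟨fun a ha => Eventually.of_forall fun n =>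
    ha.trans_le (minRelDist_nonneg hw0 _ x), fun a ha => ?_⟩
  have hopen : IsOpen {y | relDist w y x < a} :=
    isOpen_lt ((continuous_relDist hw0 hw).comp (Continuous.prodMk_left x)) continuous_const
  obtain ⟨k, hk⟩ := hc.exists_mem_open hopen ⟨x, by simpa [relDist_self] using ha⟩
  have hka : relDist w (c k) x < a := hk
  filter_upwards [eventually_ge_atTop k] with n hn
  exact (Finset.inf'_le (fun i : Fin (n + 1) => relDist w (c i) x)
    (Finset.mem_univ (⟨k, Nat.lt_succ_of_le hn⟩ : Fin (n + 1)))).trans_lt hka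

end Positive

theorem eq_of_forall_relDist_eq {X : Type*} [MetricSpace X] {w : X → ℝ} (hw0 : ∀ x, 0 < w x)
    (hw : Continuous w) {c : ℕ → X} (hc : DenseRange c) {x y : X}
    (h : ∀ n, relDist w (c n) x = relDist w (c n) y) : x = y := by
  have hcont (z : X) : Continuous fun b => relDist w b z :=
    (continuous_relDist hw0 hw).comp (Continuous.prodMk_left z)
  have hxy : relDist w y x = relDist w y y :=
    congrFun (hc.equalizer (hcont x) (hcont y) (funext h)) y
  rw [relDist_self, relDist, div_eq_zero_iff] at hxy
  exact dist_eq_zero.1 (hxy.resolve_right (relDist_denom_pos hw0 y x).ne')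

end RelDist

namespace L2Form.IsClosedForm

variable {E : Type*} [MetricSpace E] [CompleteSpace E] [SecondCountableTopology E] [Nonempty E]
  [MeasurableSpace E] {Λ : Measure E} [IsFiniteMeasure Λ] {𝓔 : L2Form Λ}
  {w : E → ℝ} {C : ℝ}

theorem exists_compact_nest (h : 𝓔.IsClosedForm) (hw0 : ∀ x, 0 < w x) (hw : LipschitzWith 1 w)
    (hdom : ∀ (n : ℕ) (c : Fin (n + 1) → E), ∃ u : 𝓔.domain,
      (u : Lp ℝ 2 Λ) =ᵐ[Λ] minRelDist w c ∧ 𝓔.energyOne u ≤ C) :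
    ∃ K : ℕ → Set E, 𝓔.IsNest K ∧ ∀ n, IsCompact (K n) := by
  obtain ⟨c, hc⟩ := TopologicalSpace.exists_dense_seq E
  choose u huf hu using fun n : ℕ => hdom n fun i => c i
  have hlim : Tendsto (fun n => (u n : Lp ℝ 2 Λ)) atTop (𝓝 0) :=
    tendsto_Lp_of_bounded ENNReal.ofNat_ne_top huf (Lp.coeFn_zero ..)
      (fun n => abs_minRelDist_le_one hw0 _) (tendsto_minRelDist_zero hw0 hw.continuous hc)
  obtain ⟨N, hN⟩ := h.exists_isNest huf hu (fun n => minRelDist_nonneg hw0 _)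
    (antitone_minRelDist w c) hlim (fun n => continuous_minRelDist hw0 hw.continuous _)
    (fun j => Nat.one_div_pos_of_nat (α := ℝ) (n := j))
  refine ⟨_, hN, fun l => isCompact_iff_totallyBounded_isComplete.2
    ⟨totallyBounded_of_relDist_le hw0 hw fun δ hδ => ?_, (hN.1 l).isComplete⟩⟩
  obtain ⟨j, hj⟩ := exists_nat_one_div_lt hδ
  refine ⟨_, finite_range fun i : Fin (N (j + l) + 1) => c i, fun x hx => ?_⟩
  obtain ⟨i, -, hi⟩ := Finset.exists_mem_eq_inf' Finset.univ_nonempty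
    fun i : Fin (N (j + l) + 1) => relDist w (c i) x
  refine ⟨c i, mem_range_self i, ?_⟩
  calc relDist w (c i) x = minRelDist w (fun i : Fin (N (j + l) + 1) => c i) x := hi.symm
    _ ≤ 1 / ((j + l : ℕ) + 1) := mem_iInter.1 hx j
    _ ≤ 1 / ((j : ℝ) + 1) := Nat.one_div_le_one_div (Nat.le_add_right j l)
    _ ≤ δ := hj.le

theorem isQuasiRegular_of_minRelDist [OpensMeasurableSpace E] (h : 𝓔.IsClosedForm)
    (hqc : 𝓔.HasDenseQuasiContinuous) (hw0 : ∀ x, 0 < w x) (hw : LipschitzWith 1 w)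
    (hdom : ∀ (n : ℕ) (c : Fin (n + 1) → E), ∃ u : 𝓔.domain,
      (u : Lp ℝ 2 Λ) =ᵐ[Λ] minRelDist w c ∧ 𝓔.energyOne u ≤ C) :
    𝓔.IsQuasiRegular where
  compact_nest := h.exists_compact_nest hw0 hw hdom
  dense_quasiContinuous := hqc
  separating := by
    obtain ⟨c, hc⟩ := TopologicalSpace.exists_dense_seq E
    refine ⟨∅, fun n => relDist w (c n), 𝓔.cap_empty, fun n => ⟨?_, ?_⟩, fun x _ y _ hxy => ?_⟩
    · exact 𝓔.quasiContinuous_of_continuous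
        ((continuous_relDist hw0 hw.continuous).comp (Continuous.prodMk_right (c n)))
    · obtain ⟨u, hu, -⟩ := hdom 0 fun _ => c n
      exact ⟨u, by rwa [minRelDist_const] at hu⟩
    · contrapose! hxy
      exact eq_of_forall_relDist_eq hw0 hw.continuous hc hxy

end L2Form.IsClosedForm

section SmoothMax

/-- The smooth maximum `β⁻¹ log ∑ᵢ exp(β hᵢ)`; it exceeds the maximum by at most `β⁻¹ log |ι|`. -/
noncomputable def smoothMax {ι : Type*} [Fintype ι] (β : ℝ) (h : ι → ℝ) : ℝ :=
  β⁻¹ * Real.log (∑ i, Real.exp (β * h i))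

variable {ι : Type*} [Fintype ι] {β : ℝ}

theorem le_smoothMax (hβ : 0 < β) (h : ι → ℝ) (i : ι) : h i ≤ smoothMax β h := by
  rw [smoothMax, inv_mul_eq_div, le_div_iff₀' hβ, ← Real.log_exp (β * h i)]
  exact Real.log_le_log (Real.exp_pos _) (Finset.single_le_sum
    (f := fun i => Real.exp (β * h i)) (fun _ _ => (Real.exp_pos _).le) (Finset.mem_univ i))

variable [Nonempty ι]

theorem sum_exp_pos (h : ι → ℝ) : 0 < ∑ i, Real.exp (h i) :=
  Finset.sum_pos (fun _ _ => Real.exp_pos _) Finset.univ_nonempty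

theorem smoothMax_le (hβ : 0 < β) {h : ι → ℝ} {a : ℝ} (ha : ∀ i, h i ≤ a) :
    smoothMax β h ≤ a + Real.log (Fintype.card ι) / β := by
  have hsum : ∑ i, Real.exp (β * h i) ≤ Fintype.card ι * Real.exp (β * a) := by
    rw [← nsmul_eq_mul]
    exact Finset.sum_le_card_nsmul _ _ _ fun i _ => by gcongr; exact ha i
  have hlog := Real.log_le_log (sum_exp_pos _) hsum
  rw [Real.log_mul (by simp) (Real.exp_pos _).ne', Real.log_exp] at hlog
  rw [smoothMax, inv_mul_eq_div, div_le_iff₀ hβ, add_mul, div_mul_cancel₀ _ hβ.ne']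
  linarith

variable {V : Type*} [NormedAddCommGroup V] [NormedSpace ℝ V] {h : ι → V → ℝ}

theorem contDiff_smoothMax (hh : ∀ i, ContDiff ℝ 1 (h i)) :
    ContDiff ℝ 1 fun y => smoothMax β fun i => h i y :=
  contDiff_const.mul ((ContDiff.sum fun i _ => (contDiff_const.mul (hh i)).exp).log
    fun _ => (sum_exp_pos _).ne')

theorem norm_fderiv_smoothMax_le (hβ : 0 < β) {y : V} {L : ℝ}
    (hh : ∀ i, DifferentiableAt ℝ (h i) y) (hL : ∀ i, ‖fderiv ℝ (h i) y‖ ≤ L) :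
    ‖fderiv ℝ (fun y => smoothMax β fun i => h i y) y‖ ≤ L := by
  have hpos := sum_exp_pos fun i => β * h i y
  have hd : HasFDerivAt (fun y => smoothMax β fun i => h i y)
      (β⁻¹ • (∑ i, Real.exp (β * h i y))⁻¹ •
        ∑ i, Real.exp (β * h i y) • β • fderiv ℝ (h i) y) y :=
    ((HasFDerivAt.fun_sum fun i _ =>
      ((hh i).hasFDerivAt.const_mul β).exp).log hpos.ne').const_mul β⁻¹
  rw [hd.fderiv, norm_smul, norm_smul, Real.norm_of_nonneg (inv_nonneg.2 hβ.le),
    Real.norm_of_nonneg (inv_nonneg.2 hpos.le), inv_mul_le_iff₀ hβ, inv_mul_le_iff₀ hpos,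
    Finset.sum_mul]
  refine norm_sum_le_of_le _ fun i _ => ?_
  rw [norm_smul, norm_smul, Real.norm_of_nonneg (Real.exp_pos _).le, Real.norm_of_nonneg hβ.le]
  gcongr
  exact hL i

end SmoothMax

section JapaneseBracket

/-- The Japanese bracket `⟨t⟩ = √(1 + t²)`, a smooth substitute for `1 + |t|`. -/
noncomputable def japaneseBracket (t : ℝ) : ℝ := √(1 + t ^ 2)

theorem japaneseBracket_pos (t : ℝ) : 0 < japaneseBracket t := Real.sqrt_pos.2 (by positivity)

theorem one_le_japaneseBracket (t : ℝ) : 1 ≤ japaneseBracket t :=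
  Real.one_le_sqrt.2 (le_add_of_nonneg_right (sq_nonneg t))

theorem abs_le_japaneseBracket (t : ℝ) : |t| ≤ japaneseBracket t :=
  Real.abs_le_sqrt (le_add_of_nonneg_left zero_le_one)

theorem contDiff_japaneseBracket : ContDiff ℝ 1 japaneseBracket :=
  (contDiff_const.add (contDiff_id.pow 2)).sqrt fun t => (by positivity : 0 < 1 + t ^ 2).ne'

theorem lipschitzWith_japaneseBracket : LipschitzWith 1 japaneseBracket := by
  refine lipschitzWith_of_nnnorm_deriv_le
    (contDiff_japaneseBracket.differentiable one_ne_zero) fun t => ?_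
  have hd : HasDerivAt japaneseBracket (t / japaneseBracket t) t := by
    refine ((((hasDerivAt_id t).pow 2).const_add 1).sqrt
      (by simp only [id, Pi.pow_apply]; positivity)).congr_deriv ?_
    simp only [japaneseBracket, id, Pi.pow_apply]
    field_simp
    simp
  rw [← NNReal.coe_le_coe, coe_nnnorm, hd.deriv, Real.norm_eq_abs, abs_div,
    abs_of_pos (japaneseBracket_pos t)]
  exact div_le_one_of_le₀ (abs_le_japaneseBracket t) (japaneseBracket_pos t).le

end JapaneseBracket

section SmoothRelDist

theorem norm_fderiv_div_add_le {V : Type*} [NormedAddCommGroup V] [NormedSpace ℝ V] {S T : V → ℝ}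
    {y : V} (hS : DifferentiableAt ℝ S y) (hT : DifferentiableAt ℝ T y) (hS0 : 0 < S y)
    (hT0 : 0 ≤ T y) (hS1 : ‖fderiv ℝ S y‖ ≤ 1) (hT1 : ‖fderiv ℝ T y‖ ≤ 1) :
    ‖fderiv ℝ (fun y => T y / (S y + T y)) y‖ ≤ 1 / S y := by
  have hpos : 0 < S y + T y := by linarith
  have hd : HasFDerivAt (fun y => T y / (S y + T y))
      (((S y + T y) ^ 2)⁻¹ • (S y • fderiv ℝ T y - T y • fderiv ℝ S y)) y := by
    simp only [div_eq_mul_inv]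
    refine (hT.hasFDerivAt.fun_mul ((hasDerivAt_inv hpos.ne').comp_hasFDerivAt y
      (hS.hasFDerivAt.add hT.hasFDerivAt))).congr_fderiv ?_
    ext v
    simp only [add_apply, smul_apply, sub_apply, smul_eq_mul, Function.comp_apply,
      Pi.add_apply]
    field_simp
    ring
  have hnum : ‖S y • fderiv ℝ T y - T y • fderiv ℝ S y‖ ≤ S y + T y := by
    refine (norm_sub_le _ _).trans ?_
    rw [norm_smul, norm_smul, Real.norm_of_nonneg hS0.le, Real.norm_of_nonneg hT0]
    exact add_le_add (mul_le_of_le_one_right hS0.le hT1) (mul_le_of_le_one_right hT0 hS1)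
  calc ‖fderiv ℝ (fun y => T y / (S y + T y)) y‖
      = ((S y + T y) ^ 2)⁻¹ * ‖S y • fderiv ℝ T y - T y • fderiv ℝ S y‖ := by
        rw [hd.fderiv, norm_smul, Real.norm_of_nonneg (by positivity)]
    _ ≤ ((S y + T y) ^ 2)⁻¹ * (S y + T y) := by gcongr
    _ = 1 / (S y + T y) := by field_simp
    _ ≤ 1 / S y := one_div_le_one_div_of_le hS0 (le_add_of_nonneg_right hT0)

variable {ι κ : Type*} [Fintype ι] [Fintype κ] {β : ℝ}

/-- A smooth approximation of `maxⱼ (yⱼ - aⱼ)⁺`. -/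
noncomputable def smoothGap (β : ℝ) (a y : ι → ℝ) : ℝ :=
  smoothMax β fun o : Option ι => o.elim 0 fun j => y j - a j

/-- A smooth approximation of `r / (⟨yᵢ⟩ + r)`, where `r = maxⱼ (yⱼ - aⱼ)⁺` and `i` is a
distinguished index; with `yⱼ = μ(fⱼ)`, `aⱼ = ν(fⱼ)` and `fᵢ = 1` it approximates the distance
of `μ` from `ν` relative to `⟨μ(1)⟩`. -/
noncomputable def smoothRelDist (β : ℝ) (i : ι) (a y : ι → ℝ) : ℝ :=
  smoothGap β a y / (japaneseBracket (y i) + smoothGap β a y)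

/-- A smooth approximation of the minimum over `k` of the functions `smoothRelDist β i (a k)`. -/
noncomputable def smoothMinRelDist (β : ℝ) (i : ι) (a : κ → ι → ℝ) (y : ι → ℝ) : ℝ :=
  -smoothMax β fun k => -smoothRelDist β i (a k) y

theorem smoothGap_nonneg (hβ : 0 < β) (a y : ι → ℝ) : 0 ≤ smoothGap β a y :=
  le_smoothMax hβ (fun o : Option ι => o.elim 0 fun j => y j - a j) none

theorem sub_le_smoothGap (hβ : 0 < β) (a y : ι → ℝ) (j : ι) : y j - a j ≤ smoothGap β a y :=
  le_smoothMax hβ (fun o : Option ι => o.elim 0 fun j => y j - a j) (some j)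

theorem smoothGap_le (hβ : 0 < β) {a y : ι → ℝ} {r : ℝ} (hr : 0 ≤ r) (h : ∀ j, y j - a j ≤ r) :
    smoothGap β a y ≤ r + Real.log (Fintype.card ι + 1) / β := by
  have hmax : smoothGap β a y ≤ r + Real.log (Fintype.card (Option ι)) / β :=
    smoothMax_le hβ (by rintro (_ | j); exacts [hr, h j])
  rwa [Fintype.card_option, Nat.cast_add_one] at hmax

theorem contDiff_gapTerm (a : ι → ℝ) (o : Option ι) :
    ContDiff ℝ 1 fun y : ι → ℝ => (o.elim 0 fun j => y j - a j : ℝ) := by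
  rcases o with _ | j
  · exact contDiff_const
  · exact (contDiff_apply ℝ ℝ j).sub contDiff_const

theorem contDiff_smoothGap (a : ι → ℝ) : ContDiff ℝ 1 (smoothGap β a) :=
  contDiff_smoothMax (contDiff_gapTerm a)

theorem norm_fderiv_smoothGap_le (hβ : 0 < β) (a y : ι → ℝ) : ‖fderiv ℝ (smoothGap β a) y‖ ≤ 1 := by
  refine norm_fderiv_smoothMax_le hβ
    (fun o => (contDiff_gapTerm a o).differentiable one_ne_zero y) ?_
  rintro (_ | j)
  · simp
  · simp only [Option.elim_some, fderiv_sub_const]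
    exact norm_fderiv_le_of_lipschitz ℝ (C := 1) (LipschitzWith.eval j)

theorem smoothRelDist_denom_pos (hβ : 0 < β) (i : ι) (a y : ι → ℝ) :
    0 < japaneseBracket (y i) + smoothGap β a y :=
  add_pos_of_pos_of_nonneg (japaneseBracket_pos _) (smoothGap_nonneg hβ a y)

theorem smoothRelDist_nonneg (hβ : 0 < β) (i : ι) (a y : ι → ℝ) : 0 ≤ smoothRelDist β i a y :=
  div_nonneg (smoothGap_nonneg hβ a y) (smoothRelDist_denom_pos hβ i a y).le

theorem smoothRelDist_le_one (hβ : 0 < β) (i : ι) (a y : ι → ℝ) : smoothRelDist β i a y ≤ 1 :=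
  div_le_one_of_le₀ (le_add_of_nonneg_left (japaneseBracket_pos _).le)
    (smoothRelDist_denom_pos hβ i a y).le

theorem contDiff_smoothRelDist (hβ : 0 < β) (i : ι) (a : ι → ℝ) :
    ContDiff ℝ 1 (smoothRelDist β i a) :=
  (contDiff_smoothGap a).div ((contDiff_japaneseBracket.comp (contDiff_apply ℝ ℝ i)).add
    (contDiff_smoothGap a)) fun y => (smoothRelDist_denom_pos hβ i a y).ne'

theorem norm_fderiv_smoothRelDist_le (hβ : 0 < β) (i : ι) (a y : ι → ℝ) :
    ‖fderiv ℝ (smoothRelDist β i a) y‖ ≤ 1 / japaneseBracket (y i) := by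
  refine norm_fderiv_div_add_le
    ((contDiff_japaneseBracket.comp (contDiff_apply ℝ ℝ i)).differentiable one_ne_zero y)
    ((contDiff_smoothGap a).differentiable one_ne_zero y) (japaneseBracket_pos _)
    (smoothGap_nonneg hβ a y) ?_ (norm_fderiv_smoothGap_le hβ a y)
  have hlip : LipschitzWith 1 fun y : ι → ℝ => japaneseBracket (y i) :=
    mul_one (1 : ℝ≥0) ▸
      lipschitzWith_japaneseBracket.comp (LipschitzWith.eval (α := fun _ : ι => ℝ) i)
  exact norm_fderiv_le_of_lipschitz ℝ hlip

theorem smoothMinRelDist_le (hβ : 0 < β) (i : ι) (a : κ → ι → ℝ) (y : ι → ℝ) (k : κ) :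
    smoothMinRelDist β i a y ≤ smoothRelDist β i (a k) y :=
  neg_le.1 (le_smoothMax hβ (fun k => -smoothRelDist β i (a k) y) k)

variable [Nonempty κ]

theorem le_smoothMinRelDist (hβ : 0 < β) {i : ι} {a : κ → ι → ℝ} {y : ι → ℝ} {r : ℝ}
    (hr : ∀ k, r ≤ smoothRelDist β i (a k) y) :
    r - Real.log (Fintype.card κ) / β ≤ smoothMinRelDist β i a y := by
  have hmax := smoothMax_le hβ fun k => neg_le_neg (hr k)
  rw [smoothMinRelDist]
  linarith

theorem abs_smoothMinRelDist_le_one (hβ : Fintype.card κ ≤ β) (i : ι) (a : κ → ι → ℝ)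
    (y : ι → ℝ) : |smoothMinRelDist β i a y| ≤ 1 := by
  have hcard : (0 : ℝ) < Fintype.card κ := Nat.cast_pos.2 Fintype.card_pos
  have hβ0 : 0 < β := hcard.trans_le hβ
  have hlog : Real.log (Fintype.card κ) / β ≤ 1 :=
    div_le_one_of_le₀ (by linarith [Real.log_le_sub_one_of_pos hcard]) hβ0.le
  refine abs_le.2 ⟨?_, (smoothMinRelDist_le hβ0 i a y (Classical.arbitrary κ)).trans
    (smoothRelDist_le_one hβ0 i _ y)⟩
  linarith [le_smoothMinRelDist hβ0 fun k => smoothRelDist_nonneg hβ0 i (a k) y]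

theorem contDiff_smoothMinRelDist (hβ : 0 < β) (i : ι) (a : κ → ι → ℝ) :
    ContDiff ℝ 1 (smoothMinRelDist β i a) :=
  (contDiff_smoothMax fun k => (contDiff_smoothRelDist hβ i (a k)).neg).neg

theorem norm_fderiv_smoothMinRelDist_le (hβ : 0 < β) (i : ι) (a : κ → ι → ℝ) (y : ι → ℝ) :
    ‖fderiv ℝ (smoothMinRelDist β i a) y‖ ≤ 1 / japaneseBracket (y i) := by
  unfold smoothMinRelDist
  rw [fderiv_fun_neg, norm_neg]
  refine norm_fderiv_smoothMax_le hβ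
    (fun k => (contDiff_smoothRelDist hβ i (a k)).neg.differentiable one_ne_zero y) fun k => ?_
  rw [fderiv_fun_neg, norm_neg]
  exact norm_fderiv_smoothRelDist_le hβ i (a k) y

end SmoothRelDist

section Limit

variable {y : ℕ → ℝ} {β : ℕ → ℝ}

theorem tendsto_smoothGap (hβ : ∀ m, 0 < β m)
    (hlog : Tendsto (fun m : ℕ => Real.log (m + 2) / β m) atTop (𝓝 0)) {a : ℕ → ℝ} {r : ℝ}
    (hr : 0 ≤ r) (hlub : IsLUB (range fun j => y j - a j) r) :
    Tendsto (fun m => smoothGap (β m) (fun j : Fin (m + 1) => a j) fun j => y j) atTop (𝓝 r) := by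
  have hupper (m : ℕ) : smoothGap (β m) (fun j : Fin (m + 1) => a j) (fun j => y j)
      ≤ r + Real.log (m + 2) / β m := by
    refine (smoothGap_le (hβ m) hr fun j : Fin (m + 1) =>
      hlub.1 (mem_range_self (j : ℕ))).trans_eq ?_
    rw [Fintype.card_fin, Nat.cast_add_one, add_assoc, one_add_one_eq_two]
  refine tendsto_order.2 ⟨fun b hb => ?_, fun b hb => ?_⟩
  · obtain ⟨_, ⟨j, rfl⟩, hj, -⟩ := hlub.exists_between hb
    filter_upwards [eventually_ge_atTop j] with m hm
    exact hj.trans_le (sub_le_smoothGap (hβ m) (fun j : Fin (m + 1) => a j) (fun j => y j)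
      ⟨j, Nat.lt_succ_of_le hm⟩)
  · have hlim : Tendsto (fun m : ℕ => r + Real.log (m + 2) / β m) atTop (𝓝 r) := by
      simpa using hlog.const_add r
    filter_upwards [hlim.eventually_lt_const hb] with m hm
    exact (hupper m).trans_lt hm

theorem tendsto_smoothMinRelDist {κ : Type*} [Fintype κ] [Nonempty κ] (hβ : ∀ m, 0 < β m)
    (hβ' : Tendsto β atTop atTop)
    (hlog : Tendsto (fun m : ℕ => Real.log (m + 2) / β m) atTop (𝓝 0)) {a : κ → ℕ → ℝ}
    {r : κ → ℝ} (hr : ∀ k, 0 ≤ r k) (hlub : ∀ k, IsLUB (range fun j => y j - a k j) (r k)) :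
    Tendsto (fun m => smoothMinRelDist (β m) 0 (fun k (j : Fin (m + 1)) => a k j) fun j => y j)
      atTop (𝓝 (Finset.univ.inf' Finset.univ_nonempty
        fun k => r k / (japaneseBracket (y 0) + r k))) := by
  have hmin : Tendsto (fun m => Finset.univ.inf' Finset.univ_nonempty fun k =>
      smoothRelDist (β m) 0 (fun j : Fin (m + 1) => a k j) fun j => y j) atTop
      (𝓝 (Finset.univ.inf' Finset.univ_nonempty
        fun k => r k / (japaneseBracket (y 0) + r k))) :=
    Tendsto.finset_inf'_nhds_apply _ fun k _ =>
      have hgap := tendsto_smoothGap hβ hlog (hr k) (hlub k)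
      hgap.div (hgap.const_add _)
        (add_pos_of_pos_of_nonneg (japaneseBracket_pos _) (hr k)).ne'
  have hlower := hmin.sub (hβ'.const_div_atTop (Real.log (Fintype.card κ)))
  rw [sub_zero] at hlower
  exact tendsto_of_tendsto_of_tendsto_of_le_of_le hlower hmin
    (fun m => le_smoothMinRelDist (hβ m) fun k => Finset.inf'_le _ (Finset.mem_univ k))
    (fun m => Finset.le_inf' _ _ fun k _ => smoothMinRelDist_le (hβ m) _ _ _ k)

end Limit

theorem abs_projIcc_le_one (t : ℝ) : |(projIcc (-1 : ℝ) 1 (by norm_num) t : ℝ)| ≤ 1 :=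
  abs_le.2 (projIcc (-1 : ℝ) 1 _ t).2

theorem exists_continuous_integral_abs_sub_le {M : Type*} [TopologicalSpace M] [NormalSpace M]
    [MeasurableSpace M] [BorelSpace M] (μ : Measure M) [IsFiniteMeasure μ] [μ.WeaklyRegular]
    {s : M → ℝ} (hs : Measurable s) (hs1 : ∀ x, |s x| ≤ 1) {ε : ℝ} (hε : 0 < ε) :
    ∃ f : M →ᵇ ℝ, (∀ x, |f x| ≤ 1) ∧ ∫ x, |s x - f x| ∂μ ≤ ε := by
  have hsint : Integrable s μ :=
    Integrable.of_bound hs.aestronglyMeasurable 1 (Eventually.of_forall hs1)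
  obtain ⟨g, hg, hgint⟩ := hsint.exists_boundedContinuous_integral_sub_le hε
  let c : M → ℝ := fun x => projIcc (-1 : ℝ) 1 (by norm_num) (g x)
  have hc1 (x : M) : |c x| ≤ 1 := abs_projIcc_le_one _
  refine ⟨.ofNormedAddCommGroup c (continuous_subtype_val.comp (continuous_projIcc.comp
    g.continuous)) 1 hc1, hc1, le_trans (integral_mono_of_nonneg ?_ ?_ ?_) hg⟩
  · exact Eventually.of_forall fun _ => abs_nonneg _
  · exact (hsint.sub hgint).norm
  · refine Eventually.of_forall fun x => ?_
    have hsx : s x = (projIcc (-1 : ℝ) 1 (by norm_num) (s x) : ℝ) :=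
      congrArg Subtype.val (projIcc_of_mem _ (abs_le.1 (hs1 x))).symm
    calc |s x - c x| = |(projIcc (-1 : ℝ) 1 (by norm_num) (s x) : ℝ) - c x| := by rw [← hsx]
      _ ≤ |s x - g x| := abs_projIcc_sub_projIcc _

namespace AcMeasure

variable {M : Type*} [MeasurableSpace M] {lam : Measure M}

/-- The integral `μ(φ)` of a function against an absolutely continuous measure. -/
noncomputable def eval (μ : AcMeasure lam) (φ : M → ℝ) : ℝ :=
  ∫ x, φ x ∂(μ.toFiniteMeasure : Measure M)

instance : Nonempty (AcMeasure lam) := ⟨⟨0, Measure.AbsolutelyContinuous.zero _⟩⟩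

/-- The weight `⟨μ(M)⟩` relative to which distances are measured. -/
noncomputable def massWeight (μ : AcMeasure lam) : ℝ :=
  japaneseBracket (μ.eval 1)

theorem massWeight_pos (μ : AcMeasure lam) : 0 < μ.massWeight := japaneseBracket_pos _

theorem measurable_density (μ : AcMeasure lam) : Measurable μ.density :=
  (Measure.measurable_rnDeriv _ _).ennreal_toReal

variable [SigmaFinite lam]

theorem eval_eq (μ : AcMeasure lam) (φ : M → ℝ) : μ.eval φ = ∫ x, μ.density x * φ x ∂lam :=
  (integral_rnDeriv_smul μ.ac).symm

theorem eval_sub_eval (μ ν : AcMeasure lam) {φ : M → ℝ} (hφ : Measurable φ)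
    (h1 : ∀ x, |φ x| ≤ 1) :
    μ.eval φ - ν.eval φ = ∫ x, (μ.density x - ν.density x) * φ x ∂lam := by
  have hint (κ : AcMeasure lam) : Integrable (fun x => κ.density x * φ x) lam :=
    κ.integrable_density.mul_bdd hφ.aestronglyMeasurable (Eventually.of_forall h1)
  simp only [eval_eq, ← integral_sub (hint μ) (hint ν), sub_mul]

theorem abs_eval_sub_eval_le (μ ν : AcMeasure lam) {φ : M → ℝ} (hφ : Measurable φ)
    (h1 : ∀ x, |φ x| ≤ 1) : |μ.eval φ - ν.eval φ| ≤ dist μ ν := by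
  rw [eval_sub_eval μ ν hφ h1, dist_def]
  refine abs_integral_le_integral_abs.trans (integral_mono_of_nonneg
    (Eventually.of_forall fun _ => abs_nonneg _) (integrable_abs_sub μ ν)
    (Eventually.of_forall fun x => ?_))
  exact (abs_mul _ _).trans_le (mul_le_of_le_one_right (abs_nonneg _) (h1 x))

theorem lipschitzWith_eval {φ : M → ℝ} (hφ : Measurable φ) (h1 : ∀ x, |φ x| ≤ 1) :
    LipschitzWith 1 fun μ : AcMeasure lam => μ.eval φ :=
  LipschitzWith.mk_one fun μ ν => abs_eval_sub_eval_le μ ν hφ h1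

theorem exists_dist_eq_eval (μ ν : AcMeasure lam) :
    ∃ s : M → ℝ, Measurable s ∧ (∀ x, |s x| ≤ 1) ∧ dist μ ν = μ.eval s - ν.eval s := by
  classical
  let s : M → ℝ := fun x => if ν.density x ≤ μ.density x then 1 else -1
  have hs : Measurable s := Measurable.ite
    (measurableSet_le ν.measurable_density μ.measurable_density) measurable_const measurable_const
  have hs1 (x : M) : |s x| ≤ 1 := by simp only [s]; split_ifs <;> simp
  have habs (x : M) : |μ.density x - ν.density x| = (μ.density x - ν.density x) * s x := by
    simp only [s]
    split_ifs with hx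
    · rw [abs_of_nonneg (sub_nonneg.2 hx), mul_one]
    · rw [abs_of_neg (sub_neg.2 (not_le.1 hx)), mul_neg_one]
  refine ⟨s, hs, hs1, ?_⟩
  simp only [eval_sub_eval μ ν hs hs1, dist_def, habs]

/-- The density as an element of `L¹`. -/
noncomputable def toL1 (μ : AcMeasure lam) : Lp ℝ 1 lam := μ.integrable_density.toL1 _

theorem isometry_toL1 : Isometry (toL1 : AcMeasure lam → Lp ℝ 1 lam) :=
  Isometry.of_dist_eq fun μ ν => by
    rw [dist_eq_norm, toL1, toL1, ← Integrable.toL1_sub, L1.norm_of_fun_eq_integral_norm, dist_def]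
    rfl

theorem range_toL1 : range (toL1 : AcMeasure lam → Lp ℝ 1 lam) = Ici 0 := by
  ext f
  rw [mem_Ici, ← Lp.coeFn_nonneg]
  constructor
  · rintro ⟨μ, rfl⟩
    filter_upwards [μ.integrable_density.coeFn_toL1] with x hx
    rw [toL1, hx]
    exact ENNReal.toReal_nonneg
  · intro hf
    have hfin : IsFiniteMeasure (lam.withDensity fun x => ENNReal.ofReal (f x)) :=
      isFiniteMeasure_withDensity_ofReal (L1.integrable_coeFn f).2
    refine ⟨⟨⟨_, hfin⟩, withDensity_absolutelyContinuous _ _⟩,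
      Lp.ext ((Integrable.coeFn_toL1 _).trans ?_)⟩
    filter_upwards [hf, Measure.rnDeriv_withDensity₀ lam
      (Lp.aestronglyMeasurable f).aemeasurable.ennreal_ofReal] with x hx0 hx
    simp only [density, FiniteMeasure.toMeasure_mk, hx]
    exact ENNReal.toReal_ofReal hx0

instance : CompleteSpace (AcMeasure lam) := by
  rw [completeSpace_iff_isComplete_range isometry_toL1.isUniformInducing, range_toL1]
  exact isClosed_Ici.isComplete

instance [MeasurableSpace.CountablyGenerated M] : SecondCountableTopology (AcMeasure lam) :=
  have : Fact ((1 : ℝ≥0∞) ≠ ∞) := ⟨ENNReal.one_ne_top⟩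
  isometry_toL1.isEmbedding.secondCountableTopology

theorem lipschitzWith_massWeight : LipschitzWith 1 (massWeight : AcMeasure lam → ℝ) :=
  mul_one (1 : ℝ≥0) ▸ lipschitzWith_japaneseBracket.comp
    (lipschitzWith_eval measurable_one fun _ => by simp)

variable [TopologicalSpace M] [TopologicalSpace.PseudoMetrizableSpace M]
  [SecondCountableTopology M] [BorelSpace M]

theorem isLUB_eval_sub_eval (μ ν : AcMeasure lam) :
    IsLUB {t | ∃ f : M →ᵇ ℝ, (∀ x, |f x| ≤ 1) ∧ μ.eval f - ν.eval f = t} (dist μ ν) := by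
  refine ⟨?_, fun b hb => le_of_forall_pos_le_add fun ε hε => ?_⟩
  · rintro _ ⟨f, hf1, rfl⟩
    exact (le_abs_self _).trans (abs_eval_sub_eval_le μ ν f.continuous.measurable hf1)
  obtain ⟨s, hs, hs1, hdist⟩ := exists_dist_eq_eval μ ν
  let := TopologicalSpace.pseudoMetrizableSpacePseudoMetric M
  obtain ⟨f, hf1, hf⟩ := exists_continuous_integral_abs_sub_le
    ((μ.toFiniteMeasure : Measure M) + (ν.toFiniteMeasure : Measure M)) hs hs1 hε
  have hsint (κ : AcMeasure lam) : Integrable s (κ.toFiniteMeasure : Measure M) :=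
    Integrable.of_bound hs.aestronglyMeasurable 1 (Eventually.of_forall hs1)
  have hsub (κ : AcMeasure lam) :
      |κ.eval s - κ.eval f| ≤ ∫ x, |s x - f x| ∂(κ.toFiniteMeasure : Measure M) := by
    rw [eval, eval, ← integral_sub (hsint κ) (f.integrable _)]
    exact abs_integral_le_integral_abs
  have hsfint (κ : AcMeasure lam) :
      Integrable (fun x => |s x - f x|) (κ.toFiniteMeasure : Measure M) :=
    ((hsint κ).sub (f.integrable _)).abs
  rw [integral_add_measure (hsfint μ) (hsfint ν)] at hf
  linarith [abs_le.1 (hsub μ), abs_le.1 (hsub ν), hb ⟨f, hf1, rfl⟩]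

theorem exists_seq_isLUB_eval_sub_eval (lam : Measure M) [SigmaFinite lam] :
    ∃ f : ℕ → (M →ᵇ ℝ), f 0 = 1 ∧ (∀ j x, |f j x| ≤ 1) ∧
      ∀ μ ν : AcMeasure lam, IsLUB (range fun j => μ.eval (f j) - ν.eval (f j)) (dist μ ν) := by
  let F (f : M →ᵇ ℝ) (p : AcMeasure lam × AcMeasure lam) : ℝ := p.1.eval f - p.2.eval f
  have hcont {f : M →ᵇ ℝ} (hf : ∀ x, |f x| ≤ 1) : Continuous (F f) :=
    have heval := (lipschitzWith_eval (lam := lam) f.continuous.measurable hf).continuous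
    (heval.comp continuous_fst).sub (heval.comp continuous_snd)
  have hlub : IsLUB (F '' {f | ∀ x, |f x| ≤ 1}) fun p => dist p.1 p.2 :=
    isLUB_pi.2 fun p => by
      convert! isLUB_eval_sub_eval p.1 p.2
      ext
      simp [F]
  obtain ⟨𝓕, h𝓕, hcount, hlub'⟩ := exists_countable_lowerSemicontinuous_isLUB
    (by rintro _ ⟨f, hf, rfl⟩; exact (hcont hf).lowerSemicontinuous) hlub
  obtain ⟨g, rfl⟩ := hcount.exists_eq_range hlub'.nonempty
  choose f hf1 hf using fun j => h𝓕 (mem_range_self j)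
  refine ⟨fun j => j.casesOn 1 f, rfl, fun j x => ?_, fun μ ν => ⟨?_, fun b hb => ?_⟩⟩
  · rcases j with _ | j
    exacts [by simp, hf1 j x]
  · rintro _ ⟨_ | j, rfl⟩
    exacts [(isLUB_eval_sub_eval μ ν).1 ⟨1, by simp, rfl⟩,
      (isLUB_eval_sub_eval μ ν).1 ⟨f j, hf1 j, rfl⟩]
  · refine (isLUB_pi.1 hlub' (μ, ν)).2 ?_
    rintro _ ⟨_, ⟨j, rfl⟩, rfl⟩
    rw [← hf j]
    exact hb ⟨j + 1, rfl⟩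

end AcMeasure

section CylinderDerivatives

theorem derivWithin_Ici_eq_fderiv {V : Type*} [NormedAddCommGroup V] [NormedSpace ℝ V] {g : V → ℝ}
    {y v : V} {F : ℝ → ℝ} (hg : DifferentiableAt ℝ g y)
    (hF : F =ᶠ[𝓝[≥] 0] fun ε => g (y + ε • v)) : derivWithin F (Ici 0) 0 = fderiv ℝ g y v := by
  rw [hF.derivWithin_eq_of_mem self_mem_Ici]
  exact (HasDerivAt.hasDerivWithinAt (hg.hasFDerivAt.hasLineDerivAt v)).derivWithin
    (uniqueDiffOn_Ici 0 0 self_mem_Ici)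

variable {M : Type*} [TopologicalSpace M] [MeasurableSpace M] [OpensMeasurableSpace M]

theorem integral_smul_add_smul_diracFin (φ : M →ᵇ ℝ) (μ : FiniteMeasure M) (x : M) (a b : ℝ≥0) :
    ∫ z, φ z ∂((a • μ + b • diracFin x : FiniteMeasure M) : Measure M) =
      a * ∫ z, φ z ∂(μ : Measure M) + b * φ x := by
  rw [FiniteMeasure.toMeasure_add, integral_add_measure (φ.integrable _) (φ.integrable _),
    FiniteMeasure.toMeasure_smul, FiniteMeasure.toMeasure_smul, integral_smul_nnreal_measure,
    integral_smul_nnreal_measure, diracFin, FiniteMeasure.toMeasure_mk,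
    integral_dirac' _ _ φ.continuous.stronglyMeasurable]
  rfl

variable {ι : Type*} [Finite ι] {f : ι → (M →ᵇ ℝ)} {g : (ι → ℝ) → ℝ} (hg : Differentiable ℝ g)
  (μ : FiniteMeasure M) (x : M)

include hg

theorem extrinsicDeriv_cylinder :
    extrinsicDeriv (fun μ => g fun i => ∫ z, f i z ∂(μ : Measure M)) μ x =
      fderiv ℝ g (fun i => ∫ z, f i z ∂(μ : Measure M)) fun i => f i x := by
  have := Fintype.ofFinite ι
  refine derivWithin_Ici_eq_fderiv (hg _) ?_
  filter_upwards [self_mem_nhdsWithin] with ε hε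
  have hint (i : ι) := integral_smul_add_smul_diracFin (f i) μ x 1 ε.toNNReal
  simp only [one_smul, Real.coe_toNNReal _ (mem_Ici.1 hε), NNReal.coe_one, one_mul] at hint
  simp only [hint]
  rfl

theorem convExtrinsicDeriv_cylinder :
    convExtrinsicDeriv (fun μ => g fun i => ∫ z, f i z ∂(μ : Measure M)) μ x =
      fderiv ℝ g (fun i => ∫ z, f i z ∂(μ : Measure M))
        fun i => f i x - ∫ z, f i z ∂(μ : Measure M) := by
  have := Fintype.ofFinite ι
  refine derivWithin_Ici_eq_fderiv (hg _) ?_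
  filter_upwards [Icc_mem_nhdsGE zero_lt_one] with ε hε
  refine congrArg g (funext fun i => ?_)
  rw [integral_smul_add_smul_diracFin, Real.coe_toNNReal _ hε.1,
    Real.coe_toNNReal _ (sub_nonneg.2 hε.2), Pi.add_apply, Pi.smul_apply, smul_eq_mul]
  ring

end CylinderDerivatives

section CylinderBound

theorem supNorm_sq_le_one {M : Type*} [MeasurableSpace M] {u : FiniteMeasure M → ℝ}
    (hu : ∀ μ, |u μ| ≤ 1) : supNorm u ^ 2 ≤ 1 :=
  pow_le_one₀ zero_le (iSup_le fun μ => enorm_le_coe.2 (hu μ : ‖u μ‖ ≤ 1))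

/-- A uniform energy bound for the cylinder functions `g(μ(f₀), …, μ(fₘ))` with `f₀ = 1`,
`|fᵢ| ≤ 1`, `|g| ≤ 1` and `‖g'(y)‖ ≤ ⟨y₀⟩⁻¹`. -/
def HasCylinderBound {M : Type*} [TopologicalSpace M] [MeasurableSpace M] {lam : Measure M}
    [SigmaFinite lam] {Λ : Measure (AcMeasure lam)} (𝓔 : L2Form Λ) (c : ℝ≥0) : Prop :=
  ∀ (m : ℕ) (f : Fin (m + 1) → (M →ᵇ ℝ)) (g : (Fin (m + 1) → ℝ) → ℝ), f 0 = 1 →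
    (∀ i x, |f i x| ≤ 1) → ContDiff ℝ 1 g → (∀ y, |g y| ≤ 1) →
    (∀ y, ‖fderiv ℝ g y‖ ≤ 1 / japaneseBracket (y 0)) →
    𝓔.energy (fun μ => g fun i => μ.eval (f i)) ≤ c

variable {M : Type*} [TopologicalSpace M] [MeasurableSpace M] {m : ℕ}
  {f : Fin (m + 1) → (M →ᵇ ℝ)} {g : (Fin (m + 1) → ℝ) → ℝ}

theorem one_div_japaneseBracket_le_one (t : ℝ) : 1 / japaneseBracket t ≤ 1 :=
  div_le_one_of_le₀ (one_le_japaneseBracket t) (japaneseBracket_pos t).le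

theorem isCylinder_of_norm_fderiv_le (hg : ContDiff ℝ 1 g) (hg1 : ∀ y, |g y| ≤ 1)
    (hg' : ∀ y, ‖fderiv ℝ g y‖ ≤ 1 / japaneseBracket (y 0)) :
    IsCylinder fun μ : FiniteMeasure M => g fun i => ∫ x, f i x ∂(μ : Measure M) :=
  ⟨m + 1, f, g, hg, ⟨1, fun y => ⟨hg1 y, (hg' y).trans (one_div_japaneseBracket_le_one _)⟩⟩,
    fun _ => rfl⟩

variable [OpensMeasurableSpace M]

section DerivativeBound

variable (hf1 : ∀ i x, |f i x| ≤ 1) (hg : Differentiable ℝ g)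
  (hg' : ∀ y, ‖fderiv ℝ g y‖ ≤ 1 / japaneseBracket (y 0)) (μ : FiniteMeasure M)

include hf1 hg hg'

theorem normL1PlusLinf_extrinsicDeriv_cylinder_le (hf0 : f 0 = 1) :
    normL1PlusLinf (extrinsicDeriv (fun μ => g fun i => ∫ x, f i x ∂(μ : Measure M)) μ) μ ≤ 2 := by
  set D := extrinsicDeriv (fun μ => g fun i => ∫ x, f i x ∂(μ : Measure M)) μ
  have hD (x : M) : ‖D x‖ ≤ 1 / japaneseBracket ((μ : Measure M).real univ) := by
    have hmass : ∫ x, f 0 x ∂(μ : Measure M) = (μ : Measure M).real univ := by simp [hf0]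
    rw [show D x = _ from extrinsicDeriv_cylinder hg μ x, ← hmass]
    exact (ContinuousLinearMap.le_of_opNorm_le_of_le _ (hg' _)
      ((pi_norm_le_iff_of_nonneg zero_le_one).2 fun i => hf1 i x)).trans_eq (mul_one _)
  have hL1 : eLpNorm D 1 μ ≤ 1 := by
    refine (eLpNorm_le_of_ae_bound (Eventually.of_forall hD)).trans ?_
    rw [ENNReal.toReal_one, inv_one, ENNReal.rpow_one, ← ofReal_measureReal,
      ← ENNReal.ofReal_mul measureReal_nonneg, mul_one_div]
    exact ENNReal.ofReal_le_one.2 (div_le_one_of_le₀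
      ((le_abs_self _).trans (abs_le_japaneseBracket _)) (japaneseBracket_pos _).le)
  have hLinf : eLpNorm D ∞ μ ≤ 1 := by
    rw [eLpNorm_exponent_top]
    exact (eLpNormEssSup_le_of_ae_bound (Eventually.of_forall hD)).trans
      (ENNReal.ofReal_le_one.2 (one_div_japaneseBracket_le_one _))
  exact (add_le_add hL1 hLinf).trans_eq one_add_one_eq_two

theorem eLpNorm_convExtrinsicDeriv_cylinder_le [IsProbabilityMeasure (μ : Measure M)] :
    eLpNorm (convExtrinsicDeriv (fun μ => g fun i => ∫ x, f i x ∂(μ : Measure M)) μ) ∞ μ ≤ 2 := by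
  have hint (i : Fin (m + 1)) : ‖∫ z, f i z ∂(μ : Measure M)‖ ≤ 1 := by
    simpa using norm_integral_le_of_norm_le_const (f := f i) (μ := (μ : Measure M))
      (Eventually.of_forall (hf1 i))
  rw [eLpNorm_exponent_top]
  refine (eLpNormEssSup_le_of_ae_bound (C := 2) (Eventually.of_forall fun x => ?_)).trans_eq
    (by simp)
  rw [convExtrinsicDeriv_cylinder hg]
  refine (ContinuousLinearMap.le_of_opNorm_le_of_le _
    ((hg' _).trans (one_div_japaneseBracket_le_one _))
    ((pi_norm_le_iff_of_nonneg zero_le_two).2 fun i => ?_)).trans_eq (one_mul _)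
  exact (norm_sub_le_of_le (hf1 i x) (hint i)).trans_eq one_add_one_eq_two

end DerivativeBound

variable {lam : Measure M} [SigmaFinite lam] {Λ : Measure (AcMeasure lam)} {𝓔 : L2Form Λ} {C : ℝ≥0}

theorem ExtDerivBound.hasCylinderBound (h : ExtDerivBound 𝓔 C) :
    HasCylinderBound 𝓔 (C * (2 ^ 2 + 1)) := by
  intro m f g hf0 hf1 hg hg1 hg'
  refine (h _ (isCylinder_of_norm_fderiv_le (f := f) hg hg1 hg')).trans ?_
  push_cast
  gcongr
  · exact iSup_le fun μ => by
      gcongr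
      exact normL1PlusLinf_extrinsicDeriv_cylinder_le hf1 (hg.differentiable one_ne_zero) hg' _ hf0
  · exact supNorm_sq_le_one fun μ => hg1 _

theorem ConvExtDerivBound.hasCylinderBound (h : ConvExtDerivBound 𝓔 C) :
    HasCylinderBound 𝓔 (C * (2 ^ 2 + 1)) := by
  intro m f g _ hf1 hg hg1 hg'
  refine (h _ (isCylinder_of_norm_fderiv_le (f := f) hg hg1 hg')).trans ?_
  push_cast
  gcongr
  · exact iSup₂_le fun μ hμ => by
      have : IsProbabilityMeasure (μ.toFiniteMeasure : Measure M) := ⟨hμ⟩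
      gcongr
      exact eLpNorm_convExtrinsicDeriv_cylinder_le hf1 (hg.differentiable one_ne_zero) hg' _
  · exact supNorm_sq_le_one fun μ => hg1 _

end CylinderBound

section MinRelDistMem

theorem norm_sq_le_one_of_ae_eq {E : Type*} [MeasurableSpace E] {Λ : Measure E}
    [IsProbabilityMeasure Λ] {p : ℝ≥0∞} [Fact (1 ≤ p)] {u : Lp ℝ p Λ} {f : E → ℝ}
    (hu : u =ᵐ[Λ] f) (hf : ∀ z, |f z| ≤ 1) : ‖u‖ ^ 2 ≤ 1 := by
  have hle := Lp.norm_le_of_ae_bound zero_le_one (hu.mono fun z hz => by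
    rw [hz]
    exact hf z)
  refine pow_le_one₀ (norm_nonneg _) ?_
  simpa [measureUnivNNReal] using hle

theorem tendsto_log_div_const_mul_add_two {c : ℝ} (hc : c ≠ 0) :
    Tendsto (fun m : ℕ => Real.log (m + 2) / (c * (m + 2))) atTop (𝓝 0) := by
  have hlim := Real.tendsto_pow_log_div_mul_add_atTop c 0 1 hc
  simp only [pow_one, add_zero] at hlim
  exact hlim.comp (tendsto_atTop_add_const_right _ _ tendsto_natCast_atTop_atTop)

variable {M : Type*} [TopologicalSpace M] [TopologicalSpace.PseudoMetrizableSpace M]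
  [SecondCountableTopology M] [MeasurableSpace M] [BorelSpace M] {lam : Measure M} [SigmaFinite lam]
  {Λ : Measure (AcMeasure lam)} [IsProbabilityMeasure Λ] {𝓔 : L2Form Λ} {c : ℝ≥0}

theorem AcMeasure.exists_cylinder_tendsto_minRelDist {n : ℕ} (ν : Fin (n + 1) → AcMeasure lam) :
    ∃ (f : ℕ → (M →ᵇ ℝ)) (g : ∀ m : ℕ, (Fin (m + 1) → ℝ) → ℝ), f 0 = 1 ∧ (∀ j x, |f j x| ≤ 1) ∧
      (∀ m, ContDiff ℝ 1 (g m)) ∧ (∀ m y, |g m y| ≤ 1) ∧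
      (∀ m y, ‖fderiv ℝ (g m) y‖ ≤ 1 / japaneseBracket (y 0)) ∧
      ∀ μ : AcMeasure lam, Tendsto (fun m => g m fun j => μ.eval (f j)) atTop
        (𝓝 (minRelDist massWeight ν μ)) := by
  obtain ⟨f, hf0, hf1, hf⟩ := exists_seq_isLUB_eval_sub_eval lam
  let β (m : ℕ) : ℝ := (n + 1) * (m + 2)
  have hβ (m : ℕ) : 0 < β m := by positivity
  have hcard (m : ℕ) : (Fintype.card (Fin (n + 1)) : ℝ) ≤ β m := by
    rw [Fintype.card_fin, Nat.cast_add_one]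
    exact le_mul_of_one_le_right (by positivity) (by linarith [m.cast_nonneg (α := ℝ)])
  have hβ' : Tendsto β atTop atTop :=
    (tendsto_atTop_add_const_right _ _ tendsto_natCast_atTop_atTop).const_mul_atTop (by positivity)
  refine ⟨f, fun m => smoothMinRelDist (β m) 0 fun k j => (ν k).eval (f j), hf0, hf1,
    fun m => contDiff_smoothMinRelDist (hβ m) _ _,
    fun m => abs_smoothMinRelDist_le_one (hcard m) _ _,
    fun m => norm_fderiv_smoothMinRelDist_le (hβ m) _ _, fun μ => ?_⟩
  have hmass : massWeight μ = japaneseBracket (μ.eval (f 0)) := by rw [hf0]; rfl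
  unfold minRelDist relDist
  rw [hmass]
  have hlog : Tendsto (fun m : ℕ => Real.log (m + 2) / β m) atTop (𝓝 0) :=
    tendsto_log_div_const_mul_add_two n.cast_add_one_ne_zero
  exact tendsto_smoothMinRelDist (y := fun j => μ.eval (f j)) (a := fun k j => (ν k).eval (f j))
    hβ hβ' hlog (fun k => dist_nonneg) fun k => hf μ (ν k)

namespace HasCylinderBound

theorem exists_minRelDist_mem (hc : HasCylinderBound 𝓔 c) (h : 𝓔.IsClosedForm) (n : ℕ)
    (ν : Fin (n + 1) → AcMeasure lam) :
    ∃ u : 𝓔.domain, (u : Lp ℝ 2 Λ) =ᵐ[Λ] minRelDist AcMeasure.massWeight ν ∧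
      𝓔.energyOne u ≤ c + 2 := by
  obtain ⟨f, g, hf0, hf1, hg, hg1, hg', hlim⟩ := AcMeasure.exists_cylinder_tendsto_minRelDist ν
  choose u hu huc using fun m => L2Form.exists_of_energy_le
    (hc m (fun j => f j) (g m) hf0 (fun j => hf1 j) (hg m) (hg1 m) (hg' m))
  have hmem : MemLp (minRelDist AcMeasure.massWeight ν) 2 Λ :=
    MemLp.of_bound (continuous_minRelDist AcMeasure.massWeight_pos
      AcMeasure.lipschitzWith_massWeight.continuous ν).aestronglyMeasurable 1
      (Eventually.of_forall (abs_minRelDist_le_one AcMeasure.massWeight_pos ν))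
  obtain ⟨x, hx, hxc⟩ := h.exists_coe_eq_of_tendsto
    (fun m => (add_le_add (huc m) (norm_sq_le_one_of_ae_eq (hu m) fun μ => hg1 m _)).trans_eq
      (by rw [add_assoc, one_add_one_eq_two]))
    (tendsto_Lp_of_bounded ENNReal.ofNat_ne_top hu hmem.coeFn_toLp (fun m μ => hg1 m _) hlim)
  exact ⟨x, hx ▸ hmem.coeFn_toLp, hxc⟩

theorem isQuasiRegular (hc : HasCylinderBound 𝓔 c) (h : 𝓔.IsClosedForm)
    (hqc : 𝓔.HasDenseQuasiContinuous) : 𝓔.IsQuasiRegular :=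
  h.isQuasiRegular_of_minRelDist hqc AcMeasure.massWeight_pos AcMeasure.lipschitzWith_massWeight
    (hc.exists_minRelDist_mem h)

end HasCylinderBound

end MinRelDistMem

section Restrict

variable {E : Type*} [MeasurableSpace E] {Λ : Measure E} {s : Set E}

theorem ae_comap_subtypeVal (hs : MeasurableSet s) (h : ∀ᵐ z ∂Λ, z ∈ s) {p : E → Prop}
    (hp : ∀ᵐ z ∂Λ, p z) : ∀ᵐ z : s ∂(Λ.comap Subtype.val), p z :=
  (measurePreserving_subtypeVal_of_ae_mem hs h).quasiMeasurePreserving.ae hp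

theorem surjective_compMeasurePreserving_subtypeVal {p : ℝ≥0∞} [Fact (1 ≤ p)]
    (hs : MeasurableSet s) (h : ∀ᵐ z ∂Λ, z ∈ s) :
    Function.Surjective (Lp.compMeasurePreservingₗᵢ (E := ℝ) (p := p) ℝ (Subtype.val : s → E)
      (measurePreserving_subtypeVal_of_ae_mem hs h)) := by
  intro v
  have hmp := measurePreserving_subtypeVal_of_ae_mem hs h
  let F : E → ℝ := Function.extend Subtype.val v 0
  have hFv : F ∘ Subtype.val = v := Function.extend_comp Subtype.val_injective _ _
  have hF : MemLp F p Λ := by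
    rw [← hmp.map_eq, (MeasurableEmbedding.subtype_coe hs).memLp_map_measure_iff, hFv]
    exact Lp.memLp v
  refine ⟨hF.toLp F, (Lp.toLp_compMeasurePreserving hF hmp).trans (Lp.ext ?_)⟩
  exact (MemLp.coeFn_toLp _).trans (Eventually.of_forall (congrFun hFv))

namespace L2Form

variable (hs : MeasurableSet s) (h : ∀ᵐ z ∂Λ, z ∈ s)

section Domain

variable (𝓔 : L2Form Λ)

/-- The identification of the domain of a form with that of its restriction. -/
noncomputable def restrictEquiv : 𝓔.domain ≃ₗ[ℝ] (𝓔.restrict hs h).domain :=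
  Submodule.equivMapOfInjective
    (Lp.compMeasurePreservingₗᵢ ℝ Subtype.val
      (measurePreserving_subtypeVal_of_ae_mem hs h)).toLinearMap
    (LinearIsometry.injective _) 𝓔.domain

theorem coe_restrictEquiv (u : 𝓔.domain) :
    (𝓔.restrictEquiv hs h u : Lp ℝ 2 (Λ.comap (Subtype.val : s → E))) =
      Lp.compMeasurePreservingₗᵢ ℝ Subtype.val (measurePreserving_subtypeVal_of_ae_mem hs h)
        (u : Lp ℝ 2 Λ) := rfl

theorem coeFn_restrictEquiv (u : 𝓔.domain) :
    (𝓔.restrictEquiv hs h u : Lp ℝ 2 (Λ.comap (Subtype.val : s → E)))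
      =ᵐ[Λ.comap Subtype.val] (u : Lp ℝ 2 Λ) ∘ Subtype.val :=
  Lp.coeFn_compMeasurePreserving _ _

theorem form_restrictEquiv (u v : 𝓔.domain) :
    (𝓔.restrict hs h).form (𝓔.restrictEquiv hs h u) (𝓔.restrictEquiv hs h v) = 𝓔.form u v := by
  change 𝓔.form ((𝓔.restrictEquiv hs h).symm (𝓔.restrictEquiv hs h u))
    ((𝓔.restrictEquiv hs h).symm (𝓔.restrictEquiv hs h v)) = 𝓔.form u v
  rw [LinearEquiv.symm_apply_apply, LinearEquiv.symm_apply_apply]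

theorem energyOne_restrictEquiv (u : 𝓔.domain) :
    (𝓔.restrict hs h).energyOne (𝓔.restrictEquiv hs h u) = 𝓔.energyOne u := by
  rw [energyOne, energyOne, form_restrictEquiv, coe_restrictEquiv, LinearIsometry.norm_map]

theorem capOpen_restrict_le (O : Set E) :
    (𝓔.restrict hs h).capOpen (Subtype.val ⁻¹' O) ≤ 𝓔.capOpen O := by
  refine le_iInf₂ fun u hu => ?_
  rw [← 𝓔.energyOne_restrictEquiv hs h]
  refine iInf₂_le _ ?_
  filter_upwards [𝓔.coeFn_restrictEquiv hs h u, ae_comap_subtypeVal hs h hu] with z hzu hz hzO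
  rw [hzu]
  exact hz hzO

theorem cap_restrict_le [TopologicalSpace E] (A : Set E) :
    (𝓔.restrict hs h).cap (Subtype.val ⁻¹' A) ≤ 𝓔.cap A :=
  le_iInf fun O => le_iInf₂ fun hO hA =>
    (iInf_le_of_le (Subtype.val ⁻¹' O)
      (iInf₂_le (hO.preimage continuous_subtype_val) (preimage_mono hA))).trans
        (𝓔.capOpen_restrict_le hs h O)

end Domain

variable {𝓔 : L2Form Λ}

theorem restrictEquiv_ae_eq {u : 𝓔.domain} {f : E → ℝ} (hu : (u : Lp ℝ 2 Λ) =ᵐ[Λ] f) :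
    (𝓔.restrictEquiv hs h u : Lp ℝ 2 (Λ.comap (Subtype.val : s → E)))
      =ᵐ[Λ.comap Subtype.val] f ∘ Subtype.val :=
  (𝓔.coeFn_restrictEquiv hs h u).trans (ae_comap_subtypeVal hs h hu)

theorem IsDirichletForm.restrict (h𝓔 : 𝓔.IsDirichletForm) :
    (𝓔.restrict hs h).IsDirichletForm where
  dense :=
    (surjective_compMeasurePreserving_subtypeVal hs h).denseRange.dense_image
      (LinearIsometry.continuous _) h𝓔.dense
  symm u v := by
    obtain ⟨u, rfl⟩ := (𝓔.restrictEquiv hs h).surjective u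
    obtain ⟨v, rfl⟩ := (𝓔.restrictEquiv hs h).surjective v
    rw [form_restrictEquiv, form_restrictEquiv, h𝓔.symm]
  nonneg u := by
    obtain ⟨u, rfl⟩ := (𝓔.restrictEquiv hs h).surjective u
    rw [form_restrictEquiv]
    exact h𝓔.nonneg u
  complete u hu := by
    obtain ⟨u, rfl⟩ := (𝓔.restrictEquiv hs h).surjective.comp_left u
    simp only [Function.comp_apply, ← map_sub, energyOne_restrictEquiv] at hu
    obtain ⟨v, hv⟩ := h𝓔.complete u hu
    refine ⟨𝓔.restrictEquiv hs h v, ?_⟩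
    simpa only [Function.comp_apply, ← map_sub, energyOne_restrictEquiv] using hv
  markov u := by
    obtain ⟨u, rfl⟩ := (𝓔.restrictEquiv hs h).surjective u
    obtain ⟨w, hw, hle⟩ := h𝓔.markov u
    refine ⟨𝓔.restrictEquiv hs h w, ?_, ?_⟩
    · filter_upwards [𝓔.coeFn_restrictEquiv hs h u, restrictEquiv_ae_eq hs h hw] with z hzu hzw
      rw [hzu, hzw, Function.comp_apply, Function.comp_apply]
    · rwa [← map_add, ← map_sub, form_restrictEquiv]

variable [TopologicalSpace E]

theorem IsNest.restrict {K : ℕ → Set E} (hK : 𝓔.IsNest K) :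
    (𝓔.restrict hs h).IsNest fun n => Subtype.val ⁻¹' K n :=
  ⟨fun n => (hK.1 n).preimage continuous_subtype_val,
    tendsto_of_tendsto_of_tendsto_of_le_of_le tendsto_const_nhds hK.2 (fun _ => zero_le)
      fun n => 𝓔.cap_restrict_le hs h (K n)ᶜ⟩

theorem QuasiContinuous.restrict {f : E → ℝ} (hf : 𝓔.QuasiContinuous f) :
    (𝓔.restrict hs h).QuasiContinuous (f ∘ Subtype.val) := by
  obtain ⟨hm, K, hK, hc⟩ := hf
  exact ⟨hm.comp measurable_subtype_coe, _, hK.restrict hs h, fun n =>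
    (hc n).comp continuous_subtype_val.continuousOn fun _ hz => hz⟩

theorem HasDenseQuasiContinuous.restrict (hqc : 𝓔.HasDenseQuasiContinuous) :
    (𝓔.restrict hs h).HasDenseQuasiContinuous := by
  obtain ⟨S, hS, hdense⟩ := hqc
  refine ⟨S.map (𝓔.restrictEquiv hs h).toLinearMap, ?_, fun u ε hε => ?_⟩
  · rintro _ ⟨u, hu, rfl⟩
    obtain ⟨f, hf, huf⟩ := hS u hu
    exact ⟨f ∘ Subtype.val, hf.restrict hs h, restrictEquiv_ae_eq hs h huf⟩
  · obtain ⟨u, rfl⟩ := (𝓔.restrictEquiv hs h).surjective u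
    obtain ⟨v, hv, hlt⟩ := hdense u ε hε
    refine ⟨𝓔.restrictEquiv hs h v, Submodule.mem_map_of_mem hv, ?_⟩
    rwa [← map_sub, energyOne_restrictEquiv]

theorem IsQuasiRegular.restrict (h𝓔 : 𝓔.IsQuasiRegular) (hsc : IsClosed s) :
    (𝓔.restrict hs h).IsQuasiRegular where
  compact_nest := by
    obtain ⟨K, hK, hKc⟩ := h𝓔.compact_nest
    exact ⟨_, hK.restrict hs h, fun n =>
      hsc.isClosedEmbedding_subtypeVal.isCompact_preimage (hKc n)⟩
  dense_quasiContinuous := h𝓔.dense_quasiContinuous.restrict hs h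
  separating := by
    obtain ⟨N, f, hN, hf, hsep⟩ := h𝓔.separating
    refine ⟨Subtype.val ⁻¹' N, fun n => f n ∘ Subtype.val,
      le_antisymm ((𝓔.cap_restrict_le hs h N).trans_eq hN) zero_le, fun n => ?_,
      fun z₁ hz₁ z₂ hz₂ hne => hsep z₁ hz₁ z₂ hz₂ (Subtype.coe_injective.ne hne)⟩
    obtain ⟨hq, u, hu⟩ := hf n
    exact ⟨hq.restrict hs h, 𝓔.restrictEquiv hs h u, restrictEquiv_ae_eq hs h hu⟩

end L2Form

end Restrict

theorem theorem2p3_general {M : Type*} [TopologicalSpace M]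
    [TopologicalSpace.PseudoMetrizableSpace M] [SecondCountableTopology M] [MeasurableSpace M]
    [BorelSpace M] (lam : Measure M) [SigmaFinite lam]
    (Λ : Measure (AcMeasure lam)) [IsProbabilityMeasure Λ]
    (𝓔 : L2Form Λ) (h𝓔 : 𝓔.IsClosedForm) (hqc : 𝓔.HasDenseQuasiContinuous) :
    ((∃ C : ℝ≥0, ExtDerivBound 𝓔 C) → 𝓔.IsQuasiRegular) ∧
    ∀ hP : Λ (probAc lam) = 1, (∃ C : ℝ≥0, ConvExtDerivBound 𝓔 C) →
      𝓔.IsQuasiRegular ∧ (𝓔.toProbAc hP).IsQuasiRegular := by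
  refine ⟨fun ⟨_, hC⟩ => hC.hasCylinderBound.isQuasiRegular h𝓔 hqc, fun _ ⟨_, hC⟩ => ?_⟩
  have hQ : 𝓔.IsQuasiRegular := hC.hasCylinderBound.isQuasiRegular h𝓔 hqc
  exact ⟨hQ, hQ.restrict _ _ (isClosed_probAc lam)⟩

theorem theorem2p3 {M : Type*} [TopologicalSpace M] [PolishSpace M] [MeasurableSpace M]
    [BorelSpace M] (lam : Measure M) [SigmaFinite lam]
    (Λ : Measure (AcMeasure lam)) [IsProbabilityMeasure Λ]
    (𝓔 : L2Form Λ) (h𝓔 : 𝓔.IsDirichletForm) (hqc : 𝓔.HasDenseQuasiContinuous) :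
    ((∃ C : ℝ≥0, 0 < C ∧ ExtDerivBound 𝓔 C) → 𝓔.IsQuasiRegular) ∧
    ∀ hP : Λ (probAc lam) = 1, (∃ C : ℝ≥0, 0 < C ∧ ConvExtDerivBound 𝓔 C) →
      𝓔.IsQuasiRegular ∧ (𝓔.toProbAc hP).IsDirichletForm ∧ (𝓔.toProbAc hP).IsQuasiRegular := by
  obtain ⟨hExt, hConv⟩ := theorem2p3_general lam Λ 𝓔 h𝓔.isClosedForm hqc
  refine ⟨fun ⟨C, _, hC⟩ => hExt ⟨C, hC⟩, fun hP ⟨C, _, hC⟩ => ?_⟩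
  obtain ⟨hQ, hQP⟩ := hConv hP ⟨C, hC⟩
  exact ⟨hQ, h𝓔.restrict _ _, hQP⟩
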